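/- Let $\mathcal M$ be a von Neumann algebra on a complex Hilbert space $\mathcal H$, let $\Omega\in\mathcal H$ be a cyclic vector for $\mathcal M$, and let $U(t)=e^{itK}$ be a strongly continuous one-parameter unitary group on $\mathcal H$ with self-adjoint generator $K$ such that $U(t)\Omega=\Omega$ and $U(t)\mathcal M U(-t)=\mathcal M$ for all $t\in\mathbb R$. Let $T(a)=e^{iaH}$ be a strongly continuous one-parameter unitary group on $\mathcal H$ such that $$T(a)\mathcal M T(-a)\subset\mathcal M\quad\text{for all } a\ge 0,$$ $$U(t)T(a)U(-t)=T(e^{t}a)\quad\text{for all } a,t\in\mathbb R .$$ Let $\mathfrak B\subset\mathcal M$ be a (not necessarily unital) $*$-subalgebra that is dense in $\mathcal M$ for the weak operator topology and satisfies $\mathfrak B\Omega\subset D(e^{-\pi K})$, where $e^{-\pi K}$ is defined by the Borel functional calculus of $K$. Suppose that at least one of the following holds: 1. $U(t)\mathfrak B U(-t)=\mathfrak B$ for all $t\in\mathbb R$, and $T(a)\mathfrak B T(-a)\subset\mathfrak B$ for all $a\ge0$; 2. $\mathfrak B$ is $\pi$-bounded with respect to $K$ and $\Omega$, i.e. there is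 a constant $C$ such that $\|e^{-\pi K}X\Omega\|\le C\|X\|$ for all $X\in\mathfrak B$. Then the generator $H$ of $T$ is positive: $\langle\xi,H\xi\rangle\ge 0$ for every $\xi\in D(H)$. -/

import Mathlib

open MeasureTheory Filter Topology

noncomputable section

/-- A strongly continuous one-parameter unitary group on a Hilbert space. -/
structure OneParameterUnitaryGroup (H : Type*) [NormedAddCommGroup H] [InnerProductSpace ℂ H]
    [CompleteSpace H] where
  /-- the operator at time `t` -/
  toFun : ℝ → (H →L[ℂ] H)
  mem_unitary' : ∀ t : ℝ, toFun t ∈ unitary (H →L[ℂ] H)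
  map_zero' : toFun 0 = 1
  map_add' : ∀ s t : ℝ, toFun (s + t) = toFun s * toFun t
  continuous' : ∀ x : H, Continuous fun t : ℝ => toFun t x

/-- A projection-valued measure on the Borel sets of `ℝ` (a resolution of the identity). -/
structure SpectralMeasure (H : Type*) [NormedAddCommGroup H] [InnerProductSpace ℂ H]
    [CompleteSpace H] where
  /-- the projection attached to a set; only its values on Borel sets are relevant -/
  proj : Set ℝ → (H →L[ℂ] H)
  isStarProjection' : ∀ s, MeasurableSet s → IsStarProjection (proj s)
  univ' : proj Set.univ = 1
  inter' : ∀ s t, MeasurableSet s → MeasurableSet t → proj (s ∩ t) = proj s * proj t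
  hasSum' : ∀ s : ℕ → Set ℝ, (∀ n, MeasurableSet (s n)) → Pairwise (Function.onFun Disjoint s) →
    ∀ x : H, HasSum (fun n => proj (s n) x) (proj (⋃ n, s n) x)

section

variable {H : Type*} [NormedAddCommGroup H] [InnerProductSpace ℂ H] [CompleteSpace H]

namespace OneParameterUnitaryGroup

instance : CoeFun (OneParameterUnitaryGroup H) (fun _ => ℝ → (H →L[ℂ] H)) :=
  ⟨fun U => U.toFun⟩

/-- The self-adjoint infinitesimal generator `K` of `U`, normalized by `U t = exp (i t K)`:
its domain consists of the `x` for which `t ↦ U t x` is differentiable at `0`, and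
`K x = -i (d/dt) U t x` at `t = 0`. -/
def generator (U : OneParameterUnitaryGroup H) : H →ₗ.[ℂ] H where
  domain :=
    { carrier := {x | DifferentiableAt ℝ (fun t : ℝ => U t x) 0}
      add_mem' := by
        intro x y hx hy
        simpa only [Set.mem_ofPred_eq, map_add] using hx.fun_add hy
      zero_mem' := by simp
      smul_mem' := by
        intro c x hx
        simpa only [Set.mem_ofPred_eq, map_smul] using hx.fun_const_smul c }
  toFun :=
    { toFun := fun x => -Complex.I • deriv (fun t : ℝ => U t (x : H)) 0
      map_add' := by
        intro x y
        simp only [Submodule.coe_add, map_add]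
        rw [deriv_fun_add x.2 y.2, smul_add]
      map_smul' := by
        intro c x
        simp only [Submodule.coe_smul, map_smul, RingHom.id_apply]
        rw [deriv_fun_const_smul c x.2, smul_comm] }

end OneParameterUnitaryGroup

namespace SpectralMeasure

variable (E : SpectralMeasure H)

theorem norm_proj_sq {s : Set ℝ} (hs : MeasurableSet s) (x : H) :
    ‖E.proj s x‖ ^ 2 = (inner ℂ x (E.proj s x)).re := by
  have h := E.isStarProjection' s hs
  have h1 : inner ℂ (E.proj s x) (E.proj s x) = inner ℂ x (E.proj s x) := by
    have h2 : ContinuousLinearMap.adjoint (E.proj s) = E.proj s := h.isSelfAdjoint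
    have h3 : E.proj s (E.proj s x) = E.proj s x := by
      have := h.isIdempotentElem.eq
      exact congrArg (fun A : H →L[ℂ] H => A x) this
    rw [← ContinuousLinearMap.adjoint_inner_right, h2, h3]
  rw [← h1]
  exact norm_sq_eq_re_inner (𝕜 := ℂ) _

theorem proj_empty : E.proj ∅ = 0 := by
  ext x
  have h : Summable fun _ : ℕ => E.proj ∅ x :=
    (E.hasSum' (fun _ => ∅) (fun _ => MeasurableSet.empty)
      (fun _ _ _ => by simp [Function.onFun]) x).summable
  simpa using (summable_const_iff _).1 h

theorem proj_union {u v : Set ℝ} (hu : MeasurableSet u) (hv : MeasurableSet v)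
    (huv : Disjoint u v) : E.proj (u ∪ v) = E.proj u + E.proj v := by
  ext x
  let s : ℕ → Set ℝ := fun n => if n = 0 then u else if n = 1 then v else ∅
  have hU : ⋃ n, s n = u ∪ v := by
    ext y
    simp only [Set.mem_iUnion, Set.mem_union]
    constructor
    · rintro ⟨n, hn⟩
      simp only [s] at hn
      split_ifs at hn <;> simp_all
    · rintro (hy | hy)
      · exact ⟨0, by simpa [s] using hy⟩
      · exact ⟨1, by simpa [s] using hy⟩
  have h := E.hasSum' s
    (by intro n; simp only [s]; split_ifs <;> simp [hu, hv])
    (by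
      intro m n hmn
      simp only [s, Function.onFun]
      split_ifs <;> simp_all [huv.symm]) x
  have h2 := hasSum_sum_of_ne_finset_zero (L := .unconditional ℕ) (f := fun n => E.proj (s n) x) (s := {0, 1})
    (by
      intro n hn
      simp only [Finset.mem_insert, Finset.mem_singleton, not_or] at hn
      simp [s, hn.1, hn.2, E.proj_empty])
  rw [← hU, h.unique h2]
  simp [s]

/-- The finite Borel measure `s ↦ ‖E(s) x‖² = ⟨x, E(s) x⟩`. -/
def measure (x : H) : Measure ℝ :=
  Measure.ofMeasurable (fun s _ => ENNReal.ofReal (‖E.proj s x‖ ^ 2))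
    (by simp [E.proj_empty])
    (by
      intro f hf hd
      have h1 : HasSum (fun n => ‖E.proj (f n) x‖ ^ 2) (‖E.proj (⋃ n, f n) x‖ ^ 2) := by
        have h2 := (E.hasSum' f hf hd x).mapL ((Complex.reCLM).comp
          ((innerSL ℂ x).restrictScalars ℝ))
        rw [E.norm_proj_sq (MeasurableSet.iUnion hf)]
        simp only [E.norm_proj_sq (hf _)]
        exact h2
      rw [← h1.tsum_eq, ENNReal.ofReal_tsum_of_nonneg (fun n => by positivity) h1.summable])

theorem measure_apply (x : H) {s : Set ℝ} (hs : MeasurableSet s) :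
    E.measure x s = ENNReal.ofReal (‖E.proj s x‖ ^ 2) :=
  Measure.ofMeasurable_apply s hs

/-- The bounded operator `s(E) = ∑ c E(s = c)` for a simple function `s`. -/
def simpleOp (s : SimpleFunc ℝ ℂ) : H →L[ℂ] H :=
  ∑ c ∈ s.range, c • E.proj (s ⁻¹' {c})

theorem simpleOp_sub (s t : SimpleFunc ℝ ℂ) :
    E.simpleOp (s - t) = E.simpleOp s - E.simpleOp t := by
  let T : Set ℝ → ℂ →L[ℝ] (H →L[ℂ] H) := fun u =>
    (ContinuousLinearMap.lsmul ℝ ℂ (E := H →L[ℂ] H)).flip (E.proj u)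
  have hT : FinMeasAdditive (0 : Measure ℝ) T := by
    intro u v hu hv _ _ huv
    simp [T, E.proj_union hu hv huv]
  have key : ∀ s : SimpleFunc ℝ ℂ, E.simpleOp s = s.setToSimpleFunc T := by
    intro s
    simp [simpleOp, SimpleFunc.setToSimpleFunc, T]
  rw [key, key, key]
  exact SimpleFunc.setToSimpleFunc_sub T hT (integrable_zero_measure) (integrable_zero_measure)

theorem enorm_simpleOp_sq (s : SimpleFunc ℝ ℂ) (x : H) :
    ‖E.simpleOp s x‖ₑ ^ 2 = ∫⁻ l, ‖s l‖ₑ ^ 2 ∂(E.measure x) := by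
  have hm : ∀ c, MeasurableSet (s ⁻¹' {c}) := fun c => s.measurableSet_preimage _
  have hsum : E.simpleOp s x = ∑ c ∈ s.range, c • E.proj (s ⁻¹' {c}) x := by
    simp [simpleOp]
  have h1 : ‖E.simpleOp s x‖ ^ 2 = ∑ c ∈ s.range, ‖c‖ ^ 2 * ‖E.proj (s ⁻¹' {c}) x‖ ^ 2 := by
    have horth : ∀ c d : ℂ, c ≠ d →
        inner ℂ (E.proj (s ⁻¹' {c}) x) (E.proj (s ⁻¹' {d}) x) = 0 := by
      intro c d hcd
      have h2 : ContinuousLinearMap.adjoint (E.proj (s ⁻¹' {c})) = E.proj (s ⁻¹' {c}) :=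
        (E.isStarProjection' _ (hm c)).isSelfAdjoint
      have h3 : E.proj (s ⁻¹' {c}) * E.proj (s ⁻¹' {d}) = 0 := by
        rw [← E.inter' _ _ (hm c) (hm d), ← Set.preimage_inter,
          Set.singleton_inter_eq_empty.2 (by simpa using hcd), Set.preimage_empty, E.proj_empty]
      have h4 : E.proj (s ⁻¹' {c}) (E.proj (s ⁻¹' {d}) x) = 0 :=
        congrArg (fun A : H →L[ℂ] H => A x) h3
      rw [← ContinuousLinearMap.adjoint_inner_right, h2, h4, inner_zero_right]
    have h5 : (inner ℂ (E.simpleOp s x) (E.simpleOp s x)) =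
        ∑ c ∈ s.range, ((‖c‖ ^ 2 * ‖E.proj (s ⁻¹' {c}) x‖ ^ 2 : ℝ) : ℂ) := by
      rw [hsum, sum_inner]
      refine Finset.sum_congr rfl fun c hc => ?_
      rw [inner_sum, Finset.sum_eq_single c]
      · rw [inner_self_eq_norm_sq_to_K, norm_smul]
        push_cast
        exact mul_pow _ _ _
      · intro d _ hd
        rw [inner_smul_left, inner_smul_right, horth c d hd.symm, mul_zero, mul_zero]
      · exact fun h => absurd hc h
    rw [inner_self_eq_norm_sq_to_K] at h5
    have h6 : ((‖E.simpleOp s x‖ ^ 2 : ℝ) : ℂ) =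
        ((∑ c ∈ s.range, ‖c‖ ^ 2 * ‖E.proj (s ⁻¹' {c}) x‖ ^ 2 : ℝ) : ℂ) := by
      rw [Complex.ofReal_sum, ← h5, Complex.ofReal_pow]
      rfl
    exact Complex.ofReal_injective h6
  have h2 : ∫⁻ l, ‖s l‖ₑ ^ 2 ∂(E.measure x) =
      ((s.map fun c : ℂ => ‖c‖ₑ ^ 2).lintegral (E.measure x)) := by
    rw [← SimpleFunc.lintegral_eq_lintegral]
    rfl
  rw [h2, SimpleFunc.map_lintegral, ← ofReal_norm, ← ENNReal.ofReal_pow (norm_nonneg _),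
    h1, ENNReal.ofReal_sum_of_nonneg (fun _ _ => by positivity)]
  refine Finset.sum_congr rfl fun c _ => ?_
  rw [E.measure_apply x (hm c), ENNReal.ofReal_mul (by positivity),
    ENNReal.ofReal_pow (norm_nonneg c), ofReal_norm]

theorem measure_add_le (x y : H) :
    E.measure (x + y) ≤ (2 : ENNReal) • (E.measure x + E.measure y) := by
  refine Measure.le_iff.2 fun s hs => ?_
  simp only [Measure.smul_apply, Measure.add_apply, E.measure_apply _ hs, map_add, smul_eq_mul]
  rw [← ENNReal.ofReal_add (by positivity) (by positivity), ← ENNReal.ofReal_ofNat,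
    ← ENNReal.ofReal_mul (by norm_num)]
  refine ENNReal.ofReal_le_ofReal ?_
  have h := norm_add_le (E.proj s x) (E.proj s y)
  have h0 := norm_nonneg (E.proj s x + E.proj s y)
  nlinarith [sq_nonneg (‖E.proj s x‖ - ‖E.proj s y‖)]

theorem measure_smul (c : ℂ) (x : H) :
    E.measure (c • x) = ENNReal.ofReal (‖c‖ ^ 2) • E.measure x := by
  refine Measure.ext fun s hs => ?_
  simp only [Measure.smul_apply, E.measure_apply _ hs, map_smul, smul_eq_mul, norm_smul]
  rw [← ENNReal.ofReal_mul (by positivity), mul_pow]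

/-- The simple functions approximating `f` used to define `f(E)`. -/
def approx (f : ℝ → ℂ) (hf : Measurable f) (n : ℕ) : SimpleFunc ℝ ℂ :=
  SimpleFunc.approxOn f hf Set.univ 0 (Set.mem_univ 0) n

theorem tendsto_approx (f : ℝ → ℂ) (hf : Measurable f) (x : H)
    (hx : ∫⁻ l, ‖f l‖ₑ ^ 2 ∂(E.measure x) < ⊤) :
    ∃ y, Tendsto (fun n => E.simpleOp (approx f hf n) x) atTop (𝓝 y) := by
  set μ := E.measure x
  have htwo : ∀ g : ℝ → ℂ, eLpNorm g 2 μ = (∫⁻ l, ‖g l‖ₑ ^ 2 ∂μ) ^ (1 / 2 : ℝ) := by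
    intro g
    rw [eLpNorm_eq_lintegral_rpow_enorm_toReal (by simp) (by simp)]
    simp
  have hop : ∀ s : SimpleFunc ℝ ℂ, ‖E.simpleOp s x‖ₑ = eLpNorm s 2 μ := by
    intro s
    rw [htwo, ← E.enorm_simpleOp_sq s x, ← ENNReal.rpow_natCast, ← ENNReal.rpow_mul]
    simp
  have hlim : Tendsto (fun n => eLpNorm (⇑(approx f hf n) - f) 2 μ) atTop (𝓝 0) := by
    refine SimpleFunc.tendsto_approxOn_Lp_eLpNorm hf (Set.mem_univ 0) (by simp) (by simp) ?_
    simp only [sub_zero]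
    rw [htwo]
    exact ENNReal.rpow_lt_top_of_nonneg (by norm_num) hx.ne
  refine cauchySeq_tendsto_of_complete ?_
  rw [EMetric.cauchySeq_iff]
  intro ε hε
  have hε2 : 0 < ε / 2 := ENNReal.half_pos hε.ne'
  obtain ⟨N, hN⟩ := eventually_atTop.1 (hlim.eventually (gt_mem_nhds hε2))
  refine ⟨N, fun m hm n hn => ?_⟩
  have e : E.simpleOp (approx f hf m) x - E.simpleOp (approx f hf n) x =
      E.simpleOp (approx f hf m - approx f hf n) x := by
    rw [simpleOp_sub]; rfl
  rw [edist_eq_enorm_sub, e, hop]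
  have hd : ⇑(approx f hf m - approx f hf n) =
      (⇑(approx f hf m) - f) - (⇑(approx f hf n) - f) := by
    simp
  rw [hd]
  calc _ ≤ eLpNorm (⇑(approx f hf m) - f) 2 μ + eLpNorm (⇑(approx f hf n) - f) 2 μ :=
        eLpNorm_sub_le
          (((approx f hf m).measurable.sub hf).aestronglyMeasurable)
          (((approx f hf n).measurable.sub hf).aestronglyMeasurable) (by norm_num)
    _ < ε / 2 + ε / 2 := ENNReal.add_lt_add (hN m hm) (hN n hn)
    _ = ε := ENNReal.add_halves ε

/-- The Borel functional calculus: `f(E) = ∫ f dE`, with domain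
`{x | ∫ |f|² dμ_x < ∞}`, `μ_x = ⟨x, E(·) x⟩`, and `f(E) x = lim s_n(E) x` for simple functions
`s_n` converging to `f` (pointwise, and in `L²(μ_x)` for all `x` in the domain). -/
def integral (f : ℝ → ℂ) (hf : Measurable f) : H →ₗ.[ℂ] H where
  domain :=
    { carrier := {x | ∫⁻ l, ‖f l‖ₑ ^ 2 ∂(E.measure x) < ⊤}
      add_mem' := by
        intro x y hx hy
        refine (lintegral_mono' (E.measure_add_le x y) le_rfl).trans_lt ?_
        rw [lintegral_smul_measure, lintegral_add_measure]
        exact ENNReal.mul_lt_top (by simp) (ENNReal.add_lt_top.2 ⟨hx, hy⟩)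
      zero_mem' := by
        have h : E.measure (0 : H) = 0 := by
          simpa using E.measure_smul 0 (0 : H)
        simp [h]
      smul_mem' := by
        intro c x hx
        simp only [Set.mem_ofPred_eq, measure_smul, lintegral_smul_measure]
        exact ENNReal.mul_lt_top (by simp) hx }
  toFun :=
    { toFun := fun x => limUnder atTop fun n => E.simpleOp (approx f hf n) (x : H)
      map_add' := by
        intro x y
        have hx := tendsto_nhds_limUnder (E.tendsto_approx f hf x x.2)
        have hy := tendsto_nhds_limUnder (E.tendsto_approx f hf y y.2)
        refine Tendsto.limUnder_eq ?_
        simpa only [Submodule.coe_add, map_add] using hx.add hy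
      map_smul' := by
        intro c x
        have hx := tendsto_nhds_limUnder (E.tendsto_approx f hf x x.2)
        refine Tendsto.limUnder_eq ?_
        simpa only [Submodule.coe_smul, map_smul, RingHom.id_apply] using hx.const_smul c }

end SpectralMeasure

open Classical in
/-- The function `f(K)` of a self-adjoint operator `K`: one has `f(K) = ∫ f dE`, where `E` is the
spectral measure of `K`, that is, `K = ∫ l dE(l)`. (For an operator without a spectral measure,
i.e. one that is not self-adjoint, the value is the operator with domain `{0}`.) -/
def borelCalculus (K : H →ₗ.[ℂ] H) (f : ℝ → ℂ) (hf : Measurable f) : H →ₗ.[ℂ] H :=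
  if h : ∃ E : SpectralMeasure H, E.integral (fun l => (l : ℂ)) Complex.measurable_ofReal = K
  then h.choose.integral f hf
  else ⊥

/-- The operator `exp (-β K)`. -/
def expNeg (β : ℝ) (K : H →ₗ.[ℂ] H) : H →ₗ.[ℂ] H :=
  borelCalculus K (fun l => (Real.exp (-(β * l)) : ℂ)) (by fun_prop)

/-- A linear subspace `S` of `B(H)` is `β`-bounded with respect to `K` and `Ω` if
`S Ω ⊆ D(exp (-β K))` and `X ↦ exp (-β K) X Ω` is a bounded map on `S`. -/
def IsBetaBounded (β : ℝ) (K : H →ₗ.[ℂ] H) (Ω : H) (S : Submodule ℂ (H →L[ℂ] H)) : Prop :=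
  ∃ h : ∀ X ∈ S, X Ω ∈ (expNeg β K).domain,
    ∃ C : ℝ, ∀ (X : H →L[ℂ] H) (hX : X ∈ S), ‖expNeg β K ⟨X Ω, h X hX⟩‖ ≤ C * ‖X‖

open scoped ComplexOrder in
/-- Positivity of an operator (the quadratic form takes values in `[0, ∞)`). -/
def IsPositiveOperator (A : H →ₗ.[ℂ] H) : Prop :=
  ∀ x : A.domain, 0 ≤ inner ℂ (x : H) (A x)

/-- `B` is dense in `M` for the weak operator topology. -/
def IsWeaklyDense (B M : Set (H →L[ℂ] H)) : Prop :=
  B ⊆ M ∧ ∀ X ∈ M, ContinuousLinearMapWOT.ofCLM X ∈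
    closure ((ContinuousLinearMapWOT.ofCLM : (H →L[ℂ] H) → (H →WOT[ℂ] H)) '' B)

/-- `Ω` is a cyclic vector for `M`. -/
def IsCyclicVector (M : Set (H →L[ℂ] H)) (Ω : H) : Prop :=
  Dense ((Submodule.span ℂ ((fun X : H →L[ℂ] H => X Ω) '' M) : Submodule ℂ H) : Set H)

end

end

/-! Write `D` for a dense subspace `𝔖Ω`, where `𝔖` is stable under conjugation by `U(t)` for all `t`
and by `T(a)` for `a ≥ 0`, and `𝔖Ω ⊂ D(e^{-πK})`. The vector `Ω` is also fixed by `T`, so `D` is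
stable under `U(t)` and under `T(a)`, `a ≥ 0`.

For `x ∈ D` the orbit `t ↦ U(t)x` has a bounded extension `F` to the strip `0 ≤ Im z ≤ π`,
holomorphic inside (`exists_isStripExtension_of_mem_domain`). Let `G` be the extension belonging to
`T(a)x`. The relation `U(t)T(a)x = T(e^t a)U(t)x` continues to `G(z) = T(e^z a)F(z)`, read weakly
against entire vectors `ξ` of `T` (`IsStripExtension.entire_apply`). On the upper edge `e^z a` is
again real, so `T` acts there by a unitary, and the maximum principle bounds `G(iπ/2) =
T(ia)F(iπ/2)` uniformly in `a`. Phragmén–Lindelöf in the half-plane `Im w ≥ 0` sharpens this to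
`|⟨ξ, T(ia)y⟩| ≤ ‖ξ‖‖y‖` for `y = F(iπ/2)`. Such `y` are dense, so the bound holds for all `y`
(`IsEntireExtension.norm_le_of_strip`). Taking `y = ξ` and differentiating at `a = 0` gives `⟨ξ, Hξ⟩
≥ 0`. Gaussian averages make the entire vectors a core for `H`, which extends the inequality to
`D(H)`.

Under the first hypothesis `𝔖 = 𝔅`. Under the second, `𝔅` need not be invariant and `𝔖 = M`: a
Kaplansky-type density theorem (`exists_bounded_approx`) approximates `XΩ`, for self-adjoint `X ∈ M`
of small norm, by `ZₙΩ` with `Zₙ` in the unit ball of `𝔅`. Then `‖e^{-πK}ZₙΩ‖` stays bounded, so `XΩ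
∈ D(e^{-πK})` (`mem_domain_of_isBetaBounded`). -/

noncomputable section

/-! ### Holomorphic functions on the strip: uniqueness and the maximum principle -/

/-- The open horizontal strip of width `π` above the real axis. -/
def piStrip : Set ℂ := Complex.im ⁻¹' Set.Ioo 0 Real.pi

/-- The closed horizontal strip of width `π` above the real axis. -/
def closedPiStrip : Set ℂ := Complex.im ⁻¹' Set.Icc 0 Real.pi

theorem isOpen_piStrip : IsOpen piStrip := isOpen_Ioo.preimage Complex.continuous_im

theorem closure_piStrip : closure piStrip = closedPiStrip := by
  rw [piStrip, Complex.closure_preimage_im, closure_Ioo Real.pi_pos.ne, closedPiStrip]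

theorem convex_piStrip : Convex ℝ piStrip :=
  (convex_Ioo 0 Real.pi).linear_preimage Complex.imLm

theorem piStrip_subset_closedPiStrip : piStrip ⊆ closedPiStrip :=
  Set.preimage_mono Set.Ioo_subset_Icc_self

section Uniqueness

variable {E : Type*} [NormedAddCommGroup E] [NormedSpace ℂ E] {f : ℂ → E}

theorem diffContOnCl_piStrip (h1 : DifferentiableOn ℂ f piStrip)
    (h2 : ContinuousOn f closedPiStrip) : DiffContOnCl ℂ f piStrip :=
  ⟨h1, closure_piStrip ▸ h2⟩

theorem DiffContOnCl.analyticOnNhd_piStrip [CompleteSpace E] (hf : DiffContOnCl ℂ f piStrip) :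
    AnalyticOnNhd ℂ f piStrip :=
  hf.differentiableOn.analyticOnNhd isOpen_piStrip

/-- A function on the strip that vanishes near an interior point vanishes on the closed strip. -/
theorem eqOn_zero_closedPiStrip_of_eventuallyEq [CompleteSpace E] (hf : DiffContOnCl ℂ f piStrip)
    {z₀ : ℂ} (hz₀ : z₀ ∈ piStrip) (h : ∃ᶠ z in 𝓝[≠] z₀, f z = 0) :
    Set.EqOn f 0 closedPiStrip := by
  have h1 := hf.analyticOnNhd_piStrip.eqOn_zero_of_preconnected_of_frequently_eq_zero
    convex_piStrip.isPreconnected hz₀ h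
  rw [← closure_piStrip]
  exact h1.of_subset_closure hf.continuousOn continuousOn_const subset_closure subset_rfl

theorem norm_exp_mul_half_disc (N : ℝ) (z : ℂ) :
    ‖Complex.exp (N * (Complex.I * z - z ^ 2))‖ =
      Real.exp (N * (-z.im - z.re ^ 2 + z.im ^ 2)) := by
  have h : (N * (Complex.I * z - z ^ 2)).re = N * (-z.im - z.re ^ 2 + z.im ^ 2) := by
    rw [Complex.re_ofReal_mul]
    simp only [pow_two, Complex.sub_re, Complex.mul_re, Complex.I_re, Complex.I_im]
    ring
  rw [Complex.norm_exp, h]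

/-- A function continuous on the closed upper half disc of radius `1/2`, holomorphic inside and
zero on the diameter, vanishes near `i/4`. -/
theorem eventuallyEq_zero_of_half_disc
    (hf : DiffContOnCl ℂ f ({z | 0 < z.im} ∩ Metric.ball 0 (1 / 2)))
    (h0 : ∀ t : ℝ, f t = 0) : ∀ᶠ z in 𝓝 (Complex.I / 4), f z = 0 := by
  set W : Set ℂ := {z | 0 < z.im} ∩ Metric.ball 0 (1 / 2) with hW
  have hWo : IsOpen W := (isOpen_lt continuous_const Complex.continuous_im).inter Metric.isOpen_ball
  have hWb : Bornology.IsBounded W := Metric.isBounded_ball.subset Set.inter_subset_right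
  have hcl : closure W ⊆ {z | 0 ≤ z.im} ∩ Metric.closedBall 0 (1 / 2) := by
    refine closure_minimal ?_ ((isClosed_le continuous_const Complex.continuous_im).inter
      Metric.isClosed_closedBall)
    exact Set.inter_subset_inter (fun z (hz : 0 < z.im) => hz.le) Metric.ball_subset_closedBall
  have hcpt : IsCompact (closure W) := hWb.isCompact_closure
  obtain ⟨C, hC⟩ := hcpt.exists_bound_of_continuousOn hf.continuousOn
  -- The multiplier `exp (N (iz - z²))` has modulus `exp (N (-y - x² + y²))`. On the arc `x² + y² =
  -- 1/4` the exponent is `N (2y² - y - 1/4) ≤ -N/4`, because `0 ≤ y ≤ 1/2`. At `i/4` it is only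
  -- `-3N/16`, so dividing the multiplier out leaves a factor that tends to zero as `N → ∞`.
  have key : ∀ (N : ℕ), ∀ z ∈ closure W,
      ‖f z‖ ≤ |C| * Real.exp (-(N * (1 / 4 + (-z.im - z.re ^ 2 + z.im ^ 2)))) := by
    intro N z hz
    let g : ℂ → E := fun z => Complex.exp ((N : ℝ) * (Complex.I * z - z ^ 2)) • f z
    have hg : DiffContOnCl ℂ g W := by
      refine DiffContOnCl.smul (Differentiable.diffContOnCl ?_) hf
      fun_prop
    have hgn : ∀ z, ‖g z‖ = Real.exp (N * (-z.im - z.re ^ 2 + z.im ^ 2)) * ‖f z‖ := by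
      intro z
      rw [norm_smul, norm_exp_mul_half_disc]
    have hb : ∀ w ∈ frontier W, ‖g w‖ ≤ |C| * Real.exp (-(N * (1 / 4))) := by
      intro w hw
      have hw1 := hcl (frontier_subset_closure hw)
      have hw2 : w ∉ W := by
        rw [hWo.frontier_eq] at hw
        exact hw.2
      rw [hgn]
      rcases (show 0 ≤ w.im from hw1.1).eq_or_lt with him | him
      · have : w = (w.re : ℂ) := by
          apply Complex.ext <;> simp [← him]
        rw [this, h0, norm_zero, mul_zero]
        positivity
      · have hn : ‖w‖ = 1 / 2 := by
          have h1 : ‖w‖ ≤ 1 / 2 := by simpa using hw1.2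
          refine le_antisymm h1 (not_lt.1 fun h2 => hw2 ⟨him, by simpa using h2⟩)
        have hsq : w.re ^ 2 + w.im ^ 2 = 1 / 4 := by
          have := Complex.sq_norm w
          rw [hn, Complex.normSq_apply] at this
          nlinarith
        have him2 : w.im ≤ 1 / 2 := by nlinarith [sq_nonneg w.re]
        rw [mul_comm]
        have hfw : ‖f w‖ ≤ |C| := (hC w (frontier_subset_closure hw)).trans (le_abs_self C)
        have hexp : Real.exp (N * (-w.im - w.re ^ 2 + w.im ^ 2)) ≤ Real.exp (-(N * (1 / 4))) := by
          apply Real.exp_le_exp.2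
          have : -w.im - w.re ^ 2 + w.im ^ 2 ≤ -(1 / 4) := by nlinarith
          nlinarith [(Nat.cast_nonneg N : (0 : ℝ) ≤ N)]
        gcongr
    have h2 := Complex.norm_le_of_forall_mem_frontier_norm_le hWb hg hb hz
    rw [hgn] at h2
    have h3 : -(N * (1 / 4 + (-z.im - z.re ^ 2 + z.im ^ 2))) =
      -(N * (1 / 4)) + -(N * (-z.im - z.re ^ 2 + z.im ^ 2)) := by ring
    rw [h3, Real.exp_add, ← mul_assoc, Real.exp_neg (N * (-z.im - z.re ^ 2 + z.im ^ 2)),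
      ← div_eq_mul_inv, le_div_iff₀ (Real.exp_pos _), mul_comm]
    exact h2
  have hmem : Complex.I / 4 ∈ W ∩ {z | 0 < 1 / 4 + (-z.im - z.re ^ 2 + z.im ^ 2)} := by
    refine ⟨⟨?_, ?_⟩, ?_⟩
    · simp
    · simp; norm_num
    · simp
  have hopen : IsOpen (W ∩ {z : ℂ | 0 < 1 / 4 + (-z.im - z.re ^ 2 + z.im ^ 2)}) := by
    refine hWo.inter (isOpen_lt continuous_const ?_)
    have := Complex.continuous_im
    have := Complex.continuous_re
    fun_prop
  filter_upwards [hopen.mem_nhds hmem] with z hz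
  have hlim : Tendsto (fun N : ℕ =>
      |C| * Real.exp (-(N * (1 / 4 + (-z.im - z.re ^ 2 + z.im ^ 2))))) atTop (𝓝 0) := by
    rw [← mul_zero |C|]
    refine Tendsto.const_mul _ (Real.tendsto_exp_neg_atTop_nhds_zero.comp ?_)
    exact tendsto_natCast_atTop_atTop.atTop_mul_const hz.2
  have := ge_of_tendsto' hlim (fun N => key N z (subset_closure hz.1))
  simpa using this

/-- Uniqueness of analytic continuation from the real line into the strip. -/
theorem eqOn_zero_closedPiStrip_of_real [CompleteSpace E] (hf : DiffContOnCl ℂ f piStrip)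
    (h0 : ∀ t : ℝ, f t = 0) : Set.EqOn f 0 closedPiStrip := by
  have h1 : DiffContOnCl ℂ f ({z | 0 < z.im} ∩ Metric.ball 0 (1 / 2)) := by
    refine hf.mono fun z hz => ?_
    have h2 : |z.im| < 1 / 2 := (Complex.abs_im_le_norm z).trans_lt (by simpa using hz.2)
    exact ⟨hz.1, by linarith [le_abs_self z.im, Real.pi_gt_three]⟩
  refine eqOn_zero_closedPiStrip_of_eventuallyEq hf (z₀ := Complex.I / 4) ?_ ?_
  · constructor
    · simp
    · simp; linarith [Real.pi_gt_three]
  · exact ((eventuallyEq_zero_of_half_disc h1 h0).filter_mono nhdsWithin_le_nhds).frequently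

theorem eqOn_closedPiStrip_of_real [CompleteSpace E] {g : ℂ → E} (hf : DiffContOnCl ℂ f piStrip)
    (hg : DiffContOnCl ℂ g piStrip) (h0 : ∀ t : ℝ, f t = g t) : Set.EqOn f g closedPiStrip := by
  have := eqOn_zero_closedPiStrip_of_real (hf.sub hg) (fun t => by simp [h0 t])
  exact fun z hz => sub_eq_zero.1 (this hz)

/-- The maximum principle for bounded functions on the strip. -/
theorem norm_le_of_boundary_closedPiStrip (hf : DiffContOnCl ℂ f piStrip) {B C : ℝ}
    (hB : ∀ z ∈ closedPiStrip, ‖f z‖ ≤ B) (h0 : ∀ t : ℝ, ‖f t‖ ≤ C)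
    (h1 : ∀ t : ℝ, ‖f (t + Real.pi * Complex.I)‖ ≤ C) {z : ℂ} (hz : z ∈ closedPiStrip) :
    ‖f z‖ ≤ C := by
  refine PhragmenLindelof.horizontal_strip hf ⟨0, by simp, 0, ?_⟩ ?_ ?_ hz.1 hz.2
  · refine Asymptotics.IsBigO.of_bound B ?_
    have : ∀ᶠ z in comap (_root_.abs ∘ Complex.re) atTop ⊓ 𝓟 (Complex.im ⁻¹' Set.Ioo 0 Real.pi),
        z ∈ Complex.im ⁻¹' Set.Ioo 0 Real.pi := mem_inf_of_right (mem_principal_self _)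
    filter_upwards [this] with z hz
    simpa using hB z (piStrip_subset_closedPiStrip hz)
  · intro z hz
    have : z = (z.re : ℂ) := by apply Complex.ext <;> simp [hz]
    rw [this]; exact h0 _
  · intro z hz
    have : z = (z.re : ℂ) + Real.pi * Complex.I := by apply Complex.ext <;> simp [hz]
    rw [this]; exact h1 _

end Uniqueness

end

/-! ### One-parameter unitary groups and their generators -/

noncomputable section

namespace OneParameterUnitaryGroup

variable {H : Type*} [NormedAddCommGroup H] [InnerProductSpace ℂ H] [CompleteSpace H]
  (U : OneParameterUnitaryGroup H)

theorem map_zero : U 0 = 1 := U.map_zero'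

theorem map_zero_apply (x : H) : U 0 x = x := by rw [map_zero]; rfl

theorem map_add_apply (s t : ℝ) (x : H) : U (s + t) x = U s (U t x) := by
  rw [U.map_add']; rfl

theorem neg_apply_apply (t : ℝ) (x : H) : U (-t) (U t x) = x := by
  rw [← U.map_add_apply, neg_add_cancel, U.map_zero_apply]

theorem star_apply (t : ℝ) : star (U t) = U (-t) := by
  have h1 : star (U t) * U t = 1 := (Unitary.mem_iff.1 (U.mem_unitary' t)).1
  have h2 : U t * U (-t) = 1 := by rw [← U.map_add', add_neg_cancel, U.map_zero]
  exact left_inv_eq_right_inv h1 h2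

theorem inner_apply_left (t : ℝ) (x y : H) : inner ℂ (U t x) y = inner ℂ x (U (-t) y) := by
  rw [← U.star_apply, ContinuousLinearMap.star_eq_adjoint,
    ContinuousLinearMap.adjoint_inner_right]

theorem norm_apply (t : ℝ) (x : H) : ‖U t x‖ = ‖x‖ := by
  have h : (inner ℂ (U t x) (U t x) : ℂ) = inner ℂ x x := by
    rw [inner_apply_left, neg_apply_apply]
  rw [inner_self_eq_norm_sq_to_K, inner_self_eq_norm_sq_to_K] at h
  have h2 : ‖U t x‖ ^ 2 = ‖x‖ ^ 2 := by exact_mod_cast h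
  exact (sq_eq_sq₀ (norm_nonneg _) (norm_nonneg _)).1 h2

theorem continuous_apply (x : H) : Continuous fun t : ℝ => U t x := U.continuous' x

theorem mem_generator_domain {x : H} :
    x ∈ U.generator.domain ↔ DifferentiableAt ℝ (fun t : ℝ => U t x) 0 := Iff.rfl

/-- For `x` in the domain of the generator, `U t x` has derivative `i K x` at `0`. -/
theorem hasDerivAt_zero (x : U.generator.domain) :
    HasDerivAt (fun t : ℝ => U t (x : H)) (Complex.I • U.generator x) 0 := by
  have h1 : DifferentiableAt ℝ (fun t : ℝ => U t (x : H)) 0 := x.2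
  have h2 : U.generator x = -Complex.I • deriv (fun t : ℝ => U t (x : H)) 0 := rfl
  rw [h2, smul_smul]
  simpa using h1.hasDerivAt

theorem hasDerivAt_apply (x : U.generator.domain) (s : ℝ) :
    HasDerivAt (fun t : ℝ => U t (x : H)) (U s (Complex.I • U.generator x)) s := by
  have h1 : HasDerivAt (fun t : ℝ => U t (x : H)) (Complex.I • U.generator x) (s - s) := by
    simpa using U.hasDerivAt_zero x
  have h2 := ((U s).restrictScalars ℝ).hasFDerivAt.comp_hasDerivAt s (h1.comp_sub_const s s)
  refine h2.congr_of_eventuallyEq (Eventually.of_forall fun t => ?_)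
  simp [← U.map_add_apply]

/-- The generator commutes with bounded operators commuting with the group. -/
theorem generator_apply_of_commute (S : H →L[ℂ] H) (hS : ∀ t x, U t (S x) = S (U t x))
    (x : U.generator.domain) :
    ∃ h : S x ∈ U.generator.domain, U.generator ⟨S x, h⟩ = S (U.generator x) := by
  have h1 : HasDerivAt (fun t : ℝ => U t (S x)) (S (Complex.I • U.generator x)) 0 := by
    have := (S.restrictScalars ℝ).hasFDerivAt.comp_hasDerivAt 0 (U.hasDerivAt_zero x)
    refine this.congr_of_eventuallyEq (Eventually.of_forall fun t => ?_)
    simp [hS]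
  refine ⟨h1.differentiableAt, ?_⟩
  have h2 : U.generator ⟨S x, h1.differentiableAt⟩ =
    -Complex.I • deriv (fun t : ℝ => U t (S x)) 0 := rfl
  rw [h2, h1.deriv, map_smul, smul_smul]
  simp

/-- The generator is symmetric: its quadratic form is real. -/
theorem im_inner_generator (x : U.generator.domain) :
    (inner ℂ (x : H) (U.generator x)).im = 0 := by
  have h1 := U.hasDerivAt_zero x
  have h2 := h1.inner ℂ h1
  have h3 : (fun t : ℝ => inner ℂ (U t (x : H)) (U t (x : H))) = fun _ => inner ℂ (x : H) x := by
    ext t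
    rw [inner_apply_left, neg_apply_apply]
  rw [h3] at h2
  have h4 := h2.unique (hasDerivAt_const _ _)
  rw [U.map_zero_apply, inner_smul_right, inner_smul_left] at h4
  have h5 := congrArg Complex.im h4
  have h6 : (inner ℂ (U.generator x) (x : H)).re = (inner ℂ (x : H) (U.generator x)).re := by
    rw [← inner_conj_symm, Complex.conj_re]
  have h7 := congrArg Complex.re h4
  have h8 : (inner ℂ (U.generator x) (x : H)).im = -(inner ℂ (x : H) (U.generator x)).im := by
    rw [← inner_conj_symm, Complex.conj_im]
  simp at h7
  linarith

/-- The group `t ↦ U (c t)`. -/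
def rescale (c : ℝ) : OneParameterUnitaryGroup H where
  toFun t := U (c * t)
  mem_unitary' t := U.mem_unitary' _
  map_zero' := by rw [mul_zero, U.map_zero]
  map_add' s t := by rw [mul_add, U.map_add']
  continuous' x := (U.continuous_apply x).comp (continuous_const.mul continuous_id)

end OneParameterUnitaryGroup

/-! ### Gaussian convolutions are entire -/

section Gaussian

variable {E : Type*} [NormedAddCommGroup E] [NormedSpace ℂ E]

theorem integrable_exp_neg_sq_half : Integrable fun s : ℝ => Real.exp (-(1 / 2) * s ^ 2) :=
  integrable_exp_neg_mul_sq (by norm_num)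

/-- The exponent is at most `-s² + 2R|s| + R²`; then use `(2R + 1)|s| ≤ s²/2 + (2R + 1)²/2`. The
spare `-|s|` absorbs the linear factor produced by differentiating the Gaussian. -/
theorem norm_cexp_neg_sq_sub_le {s R : ℝ} {w : ℂ} (hw : ‖w‖ ≤ R) :
    ‖Complex.exp (-((s : ℂ) - w) ^ 2)‖ ≤
      Real.exp ((2 * R + 1) ^ 2 / 2 + R ^ 2) * Real.exp (-(1 / 2) * s ^ 2 - |s|) := by
  have h1 : (-((s : ℂ) - w) ^ 2).re = -(s - w.re) ^ 2 + w.im ^ 2 := by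
    simp [pow_two]
    ring
  rw [Complex.norm_exp, h1, ← Real.exp_add]
  apply Real.exp_le_exp.2
  have h2 : w.re ^ 2 + w.im ^ 2 = ‖w‖ ^ 2 := by
    rw [Complex.sq_norm, Complex.normSq_apply]; ring
  have h3 : |w.re| ≤ R := (Complex.abs_re_le_norm w).trans hw
  have h4 : ‖w‖ ^ 2 ≤ R ^ 2 := by gcongr
  have h5 : s * w.re ≤ |s| * R := by
    calc s * w.re ≤ |s * w.re| := le_abs_self _
      _ = |s| * |w.re| := abs_mul _ _
      _ ≤ |s| * R := by gcongr
  nlinarith [sq_nonneg (|s| - (2 * R + 1)), sq_abs s, sq_nonneg w.re]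

theorem norm_deriv_gaussian_le {s R : ℝ} {w : ℂ} (hw : ‖w‖ ≤ R) :
    ‖2 * ((s : ℂ) - w) * Complex.exp (-((s : ℂ) - w) ^ 2)‖ ≤
      2 * Real.exp R * Real.exp ((2 * R + 1) ^ 2 / 2 + R ^ 2) * Real.exp (-(1 / 2) * s ^ 2) := by
  rw [norm_mul, norm_mul]
  have h1 : ‖(s : ℂ) - w‖ ≤ Real.exp (|s| + R) := by
    calc ‖(s : ℂ) - w‖ ≤ ‖(s : ℂ)‖ + ‖w‖ := norm_sub_le _ _
      _ ≤ |s| + R := by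
        rw [Complex.norm_real, Real.norm_eq_abs]; gcongr
      _ ≤ Real.exp (|s| + R) := by linarith [Real.add_one_le_exp (|s| + R)]
  calc ‖(2 : ℂ)‖ * ‖(s : ℂ) - w‖ * ‖Complex.exp (-((s : ℂ) - w) ^ 2)‖
      ≤ 2 * Real.exp (|s| + R) * (Real.exp ((2 * R + 1) ^ 2 / 2 + R ^ 2) *
        Real.exp (-(1 / 2) * s ^ 2 - |s|)) := by
        gcongr
        · simp
        · exact norm_cexp_neg_sq_sub_le hw
    _ = _ := by
      have : Real.exp (-(1 / 2) * s ^ 2) = Real.exp |s| * Real.exp (-(1 / 2) * s ^ 2 - |s|) := by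
        rw [← Real.exp_add]; ring_nf
      rw [this, Real.exp_add]
      ring

variable {v : ℝ → E} {C : ℝ}

theorem integrable_gaussian_smul (hv : Continuous v) (hC : ∀ s, ‖v s‖ ≤ C) (w : ℂ) :
    Integrable fun s : ℝ => Complex.exp (-((s : ℂ) - w) ^ 2) • v s := by
  refine Integrable.mono' (((integrable_exp_neg_sq_half).const_mul
    (Real.exp ((2 * ‖w‖ + 1) ^ 2 / 2 + ‖w‖ ^ 2))).mul_const C) ?_ (Eventually.of_forall fun s => ?_)
  · exact Continuous.aestronglyMeasurable (by fun_prop)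
  · rw [norm_smul]
    refine mul_le_mul ((norm_cexp_neg_sq_sub_le le_rfl).trans ?_) (hC s) (norm_nonneg _)
      (by positivity)
    gcongr
    linarith [abs_nonneg s]

/-- The Gaussian convolution of a bounded continuous function is entire. -/
theorem differentiable_gaussian_integral (hv : Continuous v) (hC : ∀ s, ‖v s‖ ≤ C) :
    Differentiable ℂ fun w : ℂ => ∫ s : ℝ, Complex.exp (-((s : ℂ) - w) ^ 2) • v s := by
  intro w₀
  set R : ℝ := ‖w₀‖ + 1
  refine (hasDerivAt_integral_of_dominated_loc_of_deriv_le
    (F' := fun w s => (2 * ((s : ℂ) - w) * Complex.exp (-((s : ℂ) - w) ^ 2)) • v s)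
    (bound := fun s => 2 * Real.exp R * Real.exp ((2 * R + 1) ^ 2 / 2 + R ^ 2) *
      Real.exp (-(1 / 2) * s ^ 2) * C)
    (Metric.ball_mem_nhds w₀ one_pos) ?_ (integrable_gaussian_smul hv hC w₀) ?_ ?_ ?_
    ?_).2.differentiableAt
  · exact Eventually.of_forall fun w => (integrable_gaussian_smul hv hC w).aestronglyMeasurable
  · exact Continuous.aestronglyMeasurable (by fun_prop)
  · refine Eventually.of_forall fun s w hw => ?_
    rw [norm_smul]
    have hwR : ‖w‖ ≤ R := by
      have h1 : ‖w - w₀‖ < 1 := by simpa [dist_eq_norm] using hw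
      have h2 := norm_add_le (w - w₀) w₀
      rw [sub_add_cancel] at h2
      simp only [R]; linarith
    exact mul_le_mul (norm_deriv_gaussian_le hwR) (hC s) (norm_nonneg _) (by positivity)
  · exact ((integrable_exp_neg_sq_half).const_mul _).mul_const C
  · refine Eventually.of_forall fun s w _ => ?_
    have h1 : HasDerivAt (fun w : ℂ => -((s : ℂ) - w) ^ 2) (2 * ((s : ℂ) - w)) w := by
      have := (((hasDerivAt_id w).const_sub (s : ℂ)).pow 2).neg
      refine this.congr_deriv ?_
      simp
    have h2 := (h1.cexp).smul_const (v s)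
    refine h2.congr_deriv ?_
    rw [mul_comm]

end Gaussian

end

/-! ### Entire vectors -/

noncomputable section

namespace OneParameterUnitaryGroup

variable {H : Type*} [NormedAddCommGroup H] [InnerProductSpace ℂ H] [CompleteSpace H]
  (U : OneParameterUnitaryGroup H)

theorem integrable_gaussian (x : H) :
    Integrable fun s : ℝ => Complex.exp (-(s : ℂ) ^ 2) • U s x := by
  simpa using integrable_gaussian_smul (U.continuous_apply x) (fun s => (U.norm_apply s x).le) 0

theorem norm_cexp_neg_sq (s : ℝ) : ‖Complex.exp (-(s : ℂ) ^ 2)‖ = Real.exp (-s ^ 2) := by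
  rw [Complex.norm_exp]
  norm_cast

/-- The Gaussian average `∫ exp (-s²) U(s) x ds`. -/
def gaussianAverage : H →L[ℂ] H :=
  LinearMap.mkContinuous
    { toFun := fun x => ∫ s : ℝ, Complex.exp (-(s : ℂ) ^ 2) • U s x
      map_add' := fun x y => by
        simp only [map_add, smul_add]
        exact integral_add (U.integrable_gaussian x) (U.integrable_gaussian y)
      map_smul' := fun c x => by
        simp only [map_smul, RingHom.id_apply]
        rw [← integral_smul]
        simp only [smul_comm c] }
    (∫ s : ℝ, Real.exp (-s ^ 2)) fun x => by
      refine (norm_integral_le_integral_norm _).trans ?_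
      rw [← integral_mul_const]
      refine le_of_eq (integral_congr_ae (Eventually.of_forall fun s => ?_))
      simp only [norm_smul, U.norm_apply, norm_cexp_neg_sq]

theorem gaussianAverage_apply (x : H) :
    U.gaussianAverage x = ∫ s : ℝ, Complex.exp (-(s : ℂ) ^ 2) • U s x := rfl

theorem commute_gaussianAverage {A : H →L[ℂ] H} (hA : ∀ s x, A (U s x) = U s (A x)) (x : H) :
    A (U.gaussianAverage x) = U.gaussianAverage (A x) := by
  rw [gaussianAverage_apply, gaussianAverage_apply,
    ← ContinuousLinearMap.integral_comp_comm _ (U.integrable_gaussian x)]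
  simp [hA]

theorem inner_gaussianAverage (x y : H) :
    inner ℂ (U.gaussianAverage x) y =
      ∫ s : ℝ, Complex.exp (-(s : ℂ) ^ 2) * inner ℂ (U s x) y := by
  rw [← inner_conj_symm, gaussianAverage_apply, ← integral_inner (U.integrable_gaussian x),
    ← integral_conj]
  refine integral_congr_ae (Eventually.of_forall fun s => ?_)
  simp only [inner_smul_right, map_mul, inner_conj_symm, ← Complex.exp_conj, map_neg, map_pow,
    Complex.conj_ofReal]

/-- Gaussian averages are entire vectors: `t ↦ ⟪G x, U(t) ·⟫` extends to an entire
function with values in the dual space. -/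
theorem exists_entire_gaussianAverage (x : H) :
    ∃ L : ℂ → (H →L[ℂ] ℂ), Differentiable ℂ L ∧
      ∀ (t : ℝ) (y : H), L t y = inner ℂ (U.gaussianAverage x) (U t y) := by
  -- Translation by `t` is moved from the group onto the Gaussian kernel, where `t` can become
  -- complex. The substitution used is `s ↦ t - s`, hence the sign in `U (-s)`.
  let v : ℝ → (H →L[ℂ] ℂ) := fun s => innerSL ℂ (U (-s) x)
  have hv : Continuous v :=
    (innerSL ℂ).continuous.comp ((U.continuous_apply x).comp continuous_neg)
  have hvn : ∀ s, ‖v s‖ ≤ ‖x‖ := fun s => by simp [v, U.norm_apply]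
  refine ⟨fun w => ∫ s : ℝ, Complex.exp (-((s : ℂ) - w) ^ 2) • v s,
    differentiable_gaussian_integral hv hvn, fun t y => ?_⟩
  rw [inner_gaussianAverage, ContinuousLinearMap.integral_apply (integrable_gaussian_smul hv hvn _),
    ← integral_sub_left_eq_self
      (fun s : ℝ => (Complex.exp (-((s : ℂ) - t) ^ 2) • v s : H →L[ℂ] ℂ) y) volume t]
  refine integral_congr_ae (Eventually.of_forall fun s => ?_)
  have h1 : inner ℂ (U s x) (U t y) = inner ℂ (U (-(t - s)) x) y := by
    have := U.inner_apply_left (-t) (U s x) y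
    rw [← U.map_add_apply, neg_neg] at this
    rw [← this]
    ring_nf
  simp only [v, FunLike.coe_smul, Pi.smul_apply, innerSL_apply_apply, smul_eq_mul, h1]
  push_cast
  ring_nf

theorem integral_cexp_neg_sq : ∫ s : ℝ, Complex.exp (-(s : ℂ) ^ 2) = (√Real.pi : ℂ) := by
  have h := integral_gaussian 1
  rw [div_one] at h
  rw [← h, ← integral_complex_ofReal]
  refine integral_congr_ae (Eventually.of_forall fun s => ?_)
  simp

/-- Gaussian averages over shrinking times converge to the identity. -/
theorem tendsto_gaussianAverage (x : H) :
    Tendsto (fun n : ℕ => (√Real.pi : ℂ)⁻¹ • (U.rescale (1 / ((n : ℝ) + 1))).gaussianAverage x)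
      atTop (𝓝 x) := by
  have hpi : (√Real.pi : ℂ) ≠ 0 := by
    exact_mod_cast (Real.sqrt_pos.2 Real.pi_pos).ne'
  have h1 : Tendsto (fun n : ℕ => (U.rescale (1 / ((n : ℝ) + 1))).gaussianAverage x) atTop
      (𝓝 (∫ s : ℝ, Complex.exp (-(s : ℂ) ^ 2) • x)) := by
    simp only [gaussianAverage_apply]
    refine tendsto_integral_of_dominated_convergence (fun s => Real.exp (-s ^ 2) * ‖x‖) ?_ ?_ ?_ ?_
    · exact fun n => ((U.rescale _).integrable_gaussian x).aestronglyMeasurable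
    · simpa using (integrable_exp_neg_mul_sq one_pos).mul_const ‖x‖
    · intro n
      refine Eventually.of_forall fun s => ?_
      rw [norm_smul, norm_apply, norm_cexp_neg_sq]
    · refine Eventually.of_forall fun s => Tendsto.const_smul ?_ _
      have h2 : Tendsto (fun n : ℕ => 1 / ((n : ℝ) + 1) * s) atTop (𝓝 0) := by
        simpa using (tendsto_one_div_add_atTop_nhds_zero_nat (𝕜 := ℝ)).mul_const s
      have h3 := (U.continuous_apply x).tendsto 0
      rw [U.map_zero_apply] at h3
      exact h3.comp h2
  rw [integral_smul_const, integral_cexp_neg_sq] at h1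
  have h2 := h1.const_smul (√Real.pi : ℂ)⁻¹
  rwa [smul_smul, inv_mul_cancel₀ hpi, one_smul] at h2

/-- `L` is an entire extension of the orbit `t ↦ ⟪ξ, U(t) ·⟫` in the dual space. -/
structure IsEntireExtension (U : OneParameterUnitaryGroup H) (ξ : H) (L : ℂ → (H →L[ℂ] ℂ)) :
    Prop where
  differentiable : Differentiable ℂ L
  real : ∀ (t : ℝ) (y : H), L t y = inner ℂ ξ (U t y)

theorem exists_isEntireExtension (n : ℕ) (x : H) : ∃ L, U.IsEntireExtension
    ((√Real.pi : ℂ)⁻¹ • (U.rescale (1 / ((n : ℝ) + 1))).gaussianAverage x) L := by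
  obtain ⟨L, hL, hL2⟩ := (U.rescale (1 / ((n : ℝ) + 1))).exists_entire_gaussianAverage x
  refine ⟨fun w => (√Real.pi : ℂ)⁻¹ • L (((n : ℝ) + 1 : ℝ) * w), ?_, fun t z => ?_⟩
  · have h1 : Differentiable ℂ fun w : ℂ => ((((n : ℝ) + 1 : ℝ) : ℂ) * w) := by fun_prop
    exact (hL.comp h1).const_smul ((√Real.pi : ℂ)⁻¹)
  · have h3 := hL2 (((n : ℝ) + 1) * t) z
    have h4 : (U.rescale (1 / ((n : ℝ) + 1))) (((n : ℝ) + 1) * t) = U t := by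
      change U (1 / ((n : ℝ) + 1) * (((n : ℝ) + 1) * t)) = U t
      congr 1
      field_simp
    rw [h4] at h3
    rw [inner_smul_left, ← h3]
    push_cast
    simp

/-- Every vector in the domain of the generator is approximated in the graph norm by entire
vectors. -/
theorem exists_entire_approx (x : U.generator.domain) :
    ∃ y : ℕ → U.generator.domain, Tendsto (fun n => (y n : H)) atTop (𝓝 (x : H)) ∧
      Tendsto (fun n => U.generator (y n)) atTop (𝓝 (U.generator x)) ∧
      ∀ n, ∃ L, U.IsEntireExtension (y n : H) L := by
  -- The averages are bounded operators commuting with `U`, hence with its generator, so convergence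
  -- at `x` and at the image of `x` is the same statement.
  let S : ℕ → H →L[ℂ] H := fun n =>
    (√Real.pi : ℂ)⁻¹ • (U.rescale (1 / ((n : ℝ) + 1))).gaussianAverage
  have hS : ∀ n t z, U t (S n z) = S n (U t z) := by
    intro n t z
    simp only [S, FunLike.coe_smul, Pi.smul_apply, map_smul]
    rw [commute_gaussianAverage]
    intro s z
    change U t (U _ z) = U _ (U t z)
    rw [← U.map_add_apply, ← U.map_add_apply, add_comm]
  choose h1 h2 using fun n => U.generator_apply_of_commute (S n) (hS n) x
  refine ⟨fun n => ⟨S n x, h1 n⟩, U.tendsto_gaussianAverage x, ?_, fun n =>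
    U.exists_isEntireExtension n x⟩
  simp only [h2]
  exact U.tendsto_gaussianAverage _

end OneParameterUnitaryGroup

end

/-! ### Strip extensions, the commutation relation and positivity -/

noncomputable section

namespace OneParameterUnitaryGroup

variable {H : Type*} [NormedAddCommGroup H] [InnerProductSpace ℂ H] [CompleteSpace H]

/-- `F` is a bounded continuous extension of the orbit `t ↦ U t x` to the closed strip
`0 ≤ Im z ≤ π`, holomorphic in the interior. -/
structure IsStripExtension (U : OneParameterUnitaryGroup H) (x : H) (F : ℂ → H) : Prop where
  diffContOnCl : DiffContOnCl ℂ F piStrip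
  bounded : ∃ C, ∀ z ∈ closedPiStrip, ‖F z‖ ≤ C
  real : ∀ t : ℝ, F t = U t x

theorem add_real_mem_piStrip {z : ℂ} (hz : z ∈ piStrip) (s : ℝ) : z + s ∈ piStrip := by
  simpa [piStrip] using hz

theorem real_mem_closedPiStrip (t : ℝ) : (t : ℂ) ∈ closedPiStrip := by
  simp [closedPiStrip, Real.pi_pos.le]

theorem real_add_pi_mem_closedPiStrip (t : ℝ) :
    (t + Real.pi * Complex.I : ℂ) ∈ closedPiStrip := by
  simp [closedPiStrip, Real.pi_pos.le]

theorem half_pi_mem_piStrip (t : ℝ) : (t + Real.pi / 2 * Complex.I : ℂ) ∈ piStrip := by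
  have := Real.pi_pos
  have h : (t + Real.pi / 2 * Complex.I : ℂ).im = Real.pi / 2 := by
    simp
  rw [piStrip, Set.mem_preimage, h]
  constructor <;> linarith

variable {U T : OneParameterUnitaryGroup H}

theorem IsStripExtension.translate {x : H} {F G : ℂ → H} (hF : U.IsStripExtension x F) (s : ℝ)
    (hG : U.IsStripExtension (U s x) G) : Set.EqOn G (fun z => F (z + s)) closedPiStrip := by
  refine eqOn_closedPiStrip_of_real hG.diffContOnCl ?_ fun t => ?_
  · refine hF.diffContOnCl.comp (Differentiable.diffContOnCl (by fun_prop)) fun z hz => ?_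
    exact add_real_mem_piStrip hz s
  · have := hF.real (t + s)
    push_cast at this
    rw [this, hG.real, U.map_add_apply]

theorem apply_comm (hUT : ∀ a t : ℝ, U t * T a * U (-t) = T (Real.exp t * a)) (a t : ℝ) (x : H) :
    U t (T a x) = T (Real.exp t * a) (U t x) := by
  rw [← hUT a t]
  simp [U.neg_apply_apply]

/-- The continuation of `U(t) T(a) = T(eᵗ a) U(t)` to complex times. -/
theorem IsStripExtension.entire_apply
    (hUT : ∀ a t : ℝ, U t * T a * U (-t) = T (Real.exp t * a)) {a : ℝ} {x ξ : H}
    {F G : ℂ → H} {L : ℂ → (H →L[ℂ] ℂ)} (hF : U.IsStripExtension x F)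
    (hG : U.IsStripExtension (T a x) G) (hL : T.IsEntireExtension ξ L) {z : ℂ}
    (hz : z ∈ closedPiStrip) : inner ℂ ξ (G z) = L (Complex.exp z * a) (F z) := by
  have hL' : Differentiable ℂ fun z => L (Complex.exp z * a) :=
    hL.differentiable.comp (by fun_prop)
  refine eqOn_closedPiStrip_of_real (f := fun z => inner ℂ ξ (G z))
    (g := fun z => L (Complex.exp z * a) (F z)) ?_ ?_ ?_ hz
  · exact (innerSL ℂ ξ).differentiable.comp_diffContOnCl hG.diffContOnCl
  · refine diffContOnCl_piStrip ?_ ?_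
    · exact hL'.differentiableOn.clm_apply hF.diffContOnCl.differentiableOn
    · rw [← closure_piStrip]
      exact hL'.continuous.continuousOn.clm_apply hF.diffContOnCl.continuousOn
  · intro t
    have := hL.real (Real.exp t * a) (U t x)
    push_cast at this
    rw [hG.real, hF.real, this, apply_comm hUT]

/-- Two vectors with equal inner products against all entire vectors are equal. -/
theorem ext_entire {y z : H}
    (h : ∀ ξ L, T.IsEntireExtension ξ L → inner ℂ ξ y = inner ℂ ξ z) : y = z := by
  refine ext_inner_left ℂ fun ξ => ?_
  have h1 := T.tendsto_gaussianAverage ξ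
  have h2 : ∀ w : H, Tendsto (fun n : ℕ => inner ℂ
      ((√Real.pi : ℂ)⁻¹ • (T.rescale (1 / ((n : ℝ) + 1))).gaussianAverage ξ) w) atTop
      (𝓝 (inner ℂ ξ w)) := fun w => h1.inner tendsto_const_nhds
  refine tendsto_nhds_unique (h2 y) ((h2 z).congr fun n => ?_)
  obtain ⟨L, hL⟩ := T.exists_isEntireExtension n ξ
  exact (h _ L hL).symm

theorem IsStripExtension.add {x y : H} {F G : ℂ → H} (hF : U.IsStripExtension x F)
    (hG : U.IsStripExtension y G) : U.IsStripExtension (x + y) (F + G) where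
  diffContOnCl := hF.diffContOnCl.add hG.diffContOnCl
  bounded := by
    obtain ⟨C, hC⟩ := hF.bounded
    obtain ⟨C', hC'⟩ := hG.bounded
    exact ⟨C + C', fun z hz => (norm_add_le _ _).trans (add_le_add (hC z hz) (hC' z hz))⟩
  real t := by simp [hF.real, hG.real]

theorem IsStripExtension.smul {x : H} {F : ℂ → H} (hF : U.IsStripExtension x F) (c : ℂ) :
    U.IsStripExtension (c • x) (c • F) where
  diffContOnCl := hF.diffContOnCl.const_smul c
  bounded := by
    obtain ⟨C, hC⟩ := hF.bounded
    refine ⟨‖c‖ * C, fun z hz => ?_⟩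
    rw [Pi.smul_apply, norm_smul]
    exact mul_le_mul_of_nonneg_left (hC z hz) (norm_nonneg c)
  real t := by simp [hF.real]

theorem IsStripExtension.zero : U.IsStripExtension 0 0 where
  diffContOnCl := diffContOnCl_const
  bounded := ⟨0, by simp⟩
  real t := by simp

/-- Absorbs the real part of a complex time into `ξ` without changing its norm, so that estimates in
the half-plane reduce to the imaginary axis. -/
theorem IsEntireExtension.translate {ξ : H} {L : ℂ → (H →L[ℂ] ℂ)} (hL : T.IsEntireExtension ξ L)
    (s : ℝ) : T.IsEntireExtension (T (-s) ξ) fun w => L (w + s) where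
  differentiable := hL.differentiable.comp (by fun_prop)
  real t y := by
    have := hL.real (t + s) y
    push_cast at this
    rw [this, inner_apply_left, neg_neg, ← T.map_add_apply, add_comm]

/-- At `z = t + iπ` the argument `e^z a` equals `-e^t a`, which is real, so the continued relation
becomes an identity between vectors. -/
theorem IsStripExtension.apply_add_pi
    (hUT : ∀ a t : ℝ, U t * T a * U (-t) = T (Real.exp t * a)) {a : ℝ} {x : H} {F G : ℂ → H}
    (hF : U.IsStripExtension x F) (hG : U.IsStripExtension (T a x) G) (t : ℝ) :
    G (t + Real.pi * Complex.I) =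
      T (-(Real.exp t * a)) (F (t + Real.pi * Complex.I)) := by
  refine ext_entire (T := T) fun ξ L hL => ?_
  rw [hF.entire_apply hUT hG hL (real_add_pi_mem_closedPiStrip t), ← hL.real, Complex.exp_add,
    Complex.exp_pi_mul_I]
  push_cast
  ring_nf

/-- On both edges of the strip `G` differs from `F` by unitaries as far as norms are concerned, so
the bound for `F` serves every `a`. The bound for `G` itself may depend on `a`; it only licenses the
maximum principle. -/
theorem IsStripExtension.exists_norm_half_pi_le
    (hUT : ∀ a t : ℝ, U t * T a * U (-t) = T (Real.exp t * a)) {x : H} {F : ℂ → H}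
    (hF : U.IsStripExtension x F) :
    ∃ C, ∀ (a : ℝ) (G : ℂ → H), U.IsStripExtension (T a x) G →
      ‖G (Real.pi / 2 * Complex.I)‖ ≤ C := by
  obtain ⟨C, hC⟩ := hF.bounded
  refine ⟨C, fun a G hG => ?_⟩
  obtain ⟨B, hB⟩ := hG.bounded
  refine norm_le_of_boundary_closedPiStrip hG.diffContOnCl hB (fun t => ?_) (fun t => ?_)
    (piStrip_subset_closedPiStrip ?_)
  · rw [hG.real, norm_apply, norm_apply, ← U.norm_apply t x, ← hF.real]
    exact hC _ (real_mem_closedPiStrip t)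
  · rw [hF.apply_add_pi hUT hG, norm_apply]
    exact hC _ (real_add_pi_mem_closedPiStrip t)
  · simpa using half_pi_mem_piStrip 0

/-- The vectors `U(iπ/2) x` with `x` in a given subspace. -/
def halfwaySubmodule (U : OneParameterUnitaryGroup H) (D : Submodule ℂ H) : Submodule ℂ H where
  carrier := {y | ∃ x ∈ D, ∃ F, U.IsStripExtension x F ∧ F (Real.pi / 2 * Complex.I) = y}
  add_mem' := by
    rintro _ _ ⟨x, hx, F, hF, rfl⟩ ⟨y, hy, G, hG, rfl⟩
    exact ⟨x + y, D.add_mem hx hy, F + G, hF.add hG, rfl⟩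
  zero_mem' := ⟨0, D.zero_mem, 0, IsStripExtension.zero, rfl⟩
  smul_mem' := by
    rintro c _ ⟨x, hx, F, hF, rfl⟩
    exact ⟨c • x, D.smul_mem c hx, c • F, hF.smul c, rfl⟩

/-- If `y` is orthogonal to every `F(iπ/2)`, replacing `x` by `U(t)x` shows that `⟨y, F⟩` vanishes
on the whole line `Im z = π/2`. By the identity theorem it vanishes at `0`, that is, `y ⊥ x`. -/
theorem dense_halfwaySubmodule {D : Submodule ℂ H} (hD : Dense (D : Set H))
    (hUD : ∀ (t : ℝ), ∀ x ∈ D, U t x ∈ D) (hF : ∀ x ∈ D, ∃ F, U.IsStripExtension x F) :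
    Dense (U.halfwaySubmodule D : Set H) := by
  rw [Submodule.dense_iff_topologicalClosure_eq_top, Submodule.topologicalClosure_eq_top_iff,
    Submodule.eq_bot_iff] at hD ⊢
  intro y hy
  refine hD y fun x hx => ?_
  obtain ⟨F, hFx⟩ := hF x hx
  have h0 : ∀ t : ℝ, inner ℂ y (F (Real.pi / 2 * Complex.I + t)) = 0 := by
    intro t
    obtain ⟨G, hG⟩ := hF (U t x) (hUD t x hx)
    have h1 := hFx.translate t hG (piStrip_subset_closedPiStrip (half_pi_mem_piStrip 0))
    simp only [Complex.ofReal_zero, zero_add] at h1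
    rw [← h1]
    exact inner_eq_zero_symm.1 (hy _ ⟨U t x, hUD t x hx, G, hG, rfl⟩)
  have h1 : DiffContOnCl ℂ (fun z => inner ℂ y (F z)) piStrip :=
    (innerSL ℂ y).differentiable.comp_diffContOnCl hFx.diffContOnCl
  have hz : (Real.pi / 2 * Complex.I : ℂ) ∈ piStrip := by simpa using half_pi_mem_piStrip 0
  have h2 := eqOn_zero_closedPiStrip_of_eventuallyEq h1 hz ?_ (real_mem_closedPiStrip 0)
  · simp only [hFx.real, U.map_zero_apply, Pi.zero_apply] at h2
    exact inner_eq_zero_symm.1 h2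
  · have h3 : Tendsto (fun n : ℕ => (Real.pi / 2 * Complex.I + ((1 / ((n : ℝ) + 1) : ℝ) : ℂ) : ℂ))
        atTop (𝓝[≠] (Real.pi / 2 * Complex.I)) := by
      refine tendsto_nhdsWithin_iff.2 ⟨?_, Eventually.of_forall fun n => ?_⟩
      · have := (Complex.continuous_ofReal.tendsto 0).comp
          (tendsto_one_div_add_atTop_nhds_zero_nat (𝕜 := ℝ))
        simpa using this.const_add (Real.pi / 2 * Complex.I : ℂ)
      · have : ((1 / ((n : ℝ) + 1) : ℝ) : ℂ) ≠ 0 :=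
          Complex.ofReal_ne_zero.2 (by positivity)
        simpa using this
    exact h3.frequently (Frequently.of_forall fun n => h0 _)

theorem IsEntireExtension.norm_le_of_strip
    (hUT : ∀ a t : ℝ, U t * T a * U (-t) = T (Real.exp t * a))
    {D : Submodule ℂ H} (hD : Dense (D : Set H)) (hUD : ∀ (t : ℝ), ∀ x ∈ D, U t x ∈ D)
    (hTD : ∀ a : ℝ, 0 ≤ a → ∀ x ∈ D, T a x ∈ D)
    (hF : ∀ x ∈ D, ∃ F, U.IsStripExtension x F) {ξ : H} {L : ℂ → (H →L[ℂ] ℂ)}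
    (hL : T.IsEntireExtension ξ L) {a : ℝ} (ha : 0 ≤ a) (y : H) :
    ‖L (Complex.I * a) y‖ ≤ ‖ξ‖ * ‖y‖ := by
  refine (dense_halfwaySubmodule hD hUD hF).induction
    (P := fun y => ‖L (Complex.I * a) y‖ ≤ ‖ξ‖ * ‖y‖)
    ?_ (isClosed_le (by fun_prop) (by fun_prop)) y
  rintro _ ⟨x, hx, F, hFx, rfl⟩
  set y := F (Real.pi / 2 * Complex.I)
  obtain ⟨C, hC⟩ := hFx.exists_norm_half_pi_le hUT
  have hz : (Real.pi / 2 * Complex.I : ℂ) ∈ closedPiStrip :=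
    piStrip_subset_closedPiStrip (by simpa using half_pi_mem_piStrip 0)
  -- Since `e^{iπ/2} = i`, the functional `L (ib + s)` at `y` is the inner product of `T(-s)ξ` with
  -- `G(iπ/2)`, where `G` extends the orbit of `T(b)x`. Here `b ≥ 0` is needed for `T(b)x` to stay
  -- in `D`.
  have hb : ∀ (b : ℝ), 0 ≤ b → ∀ s : ℝ, ‖L (Complex.I * b + s) y‖ ≤ ‖ξ‖ * C := by
    intro b hb s
    obtain ⟨G, hG⟩ := hF (T b x) (hTD b hb x hx)
    have h1 := hFx.entire_apply hUT hG (hL.translate s) hz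
    have h2 : Complex.exp (Real.pi / 2 * Complex.I) = Complex.I := Complex.exp_pi_div_two_mul_I
    rw [h2] at h1
    rw [← h1]
    refine (norm_inner_le_norm _ _).trans ?_
    rw [norm_apply]
    exact mul_le_mul_of_nonneg_left (hC b G hG) (norm_nonneg _)
  have hd : Differentiable ℂ fun w : ℂ => L (Complex.I * w) y := by
    have h1 : Differentiable ℂ fun w : ℂ => L (Complex.I * w) :=
      hL.differentiable.comp (by fun_prop)
    exact h1.clm_apply (differentiable_const y)
  have hb' : ∀ w : ℂ, 0 ≤ w.re → ‖L (Complex.I * w) y‖ ≤ ‖ξ‖ * C := by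
    intro w hw
    convert hb w.re hw (-w.im) using 4
    apply Complex.ext <;> simp
  -- After `w ↦ iw` the half-plane `Im ≥ 0` becomes `Re ≥ 0`, with imaginary axis the real times of
  -- `T`. Unitarity there replaces the crude constant `C`, which depends on `x`, by `‖y‖`; only such
  -- a bound passes to the closure.
  refine PhragmenLindelof.right_half_plane_of_bounded_on_real
    (f := fun w : ℂ => L (Complex.I * w) y) (z := (a : ℂ)) hd.diffContOnCl ?_ ?_ ?_ (by simpa)
  · refine ⟨0, by norm_num, 0, Asymptotics.IsBigO.of_bound (‖ξ‖ * C) ?_⟩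
    filter_upwards [mem_inf_of_right (mem_principal_self _)] with w hw
    simpa using hb' w (le_of_lt hw)
  · refine isBoundedUnder_of_eventually_le (a := ‖ξ‖ * C) ?_
    filter_upwards [eventually_ge_atTop 0] with r hr
    exact hb' r (by simpa using hr)
  · intro r
    have h1 : Complex.I * (r * Complex.I) = ((-r : ℝ) : ℂ) := by
      rw [mul_left_comm, Complex.I_mul_I]; simp
    rw [h1, hL.real]
    refine (norm_inner_le_norm _ _).trans ?_
    rw [norm_apply]

/-- The function `a ↦ Re L(ia)ξ` equals `‖ξ‖²` at `0` and does not exceed it for `a ≥ 0`, so its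
derivative `-Re⟨ξ, Hξ⟩` at `0` is nonpositive. -/
theorem IsEntireExtension.re_inner_generator_nonneg {ξ : T.generator.domain}
    {L : ℂ → (H →L[ℂ] ℂ)} (hL : T.IsEntireExtension (ξ : H) L)
    (hb : ∀ a : ℝ, 0 ≤ a → ‖L (Complex.I * a) ξ‖ ≤ ‖(ξ : H)‖ * ‖(ξ : H)‖) :
    0 ≤ (inner ℂ (ξ : H) (T.generator ξ)).re := by
  have hd : DifferentiableAt ℂ (fun w : ℂ => L w ξ) 0 :=
    (hL.differentiable.clm_apply (differentiable_const _)) 0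
  have h1 : deriv (fun w : ℂ => L w ξ) 0 = Complex.I * inner ℂ (ξ : H) (T.generator ξ) := by
    have h2 : HasDerivAt (fun t : ℝ => L t ξ) (deriv (fun w : ℂ => L w ξ) 0) 0 := by
      have := hd.hasDerivAt
      rw [← Complex.ofReal_zero] at this
      exact this.comp_ofReal
    have h3 : HasDerivAt (fun t : ℝ => L t ξ) (Complex.I * inner ℂ (ξ : H) (T.generator ξ)) 0 := by
      have h4 := (hasDerivAt_const (0 : ℝ) (ξ : H)).inner ℂ (T.hasDerivAt_zero ξ)
      rw [inner_zero_left, add_zero, inner_smul_right] at h4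
      simpa only [hL.real] using h4
    exact h2.unique h3
  have h2 : HasDerivAt (fun a : ℝ => (L (Complex.I * a) ξ).re)
      (-(inner ℂ (ξ : H) (T.generator ξ)).re) 0 := by
    have h3 : HasDerivAt (fun w : ℂ => L (Complex.I * w) ξ)
        (Complex.I * inner ℂ (ξ : H) (T.generator ξ) * Complex.I) ((0 : ℝ) : ℂ) := by
      have h4 : HasDerivAt (fun w : ℂ => L w ξ) (Complex.I * inner ℂ (ξ : H) (T.generator ξ))
          (Complex.I * ((0 : ℝ) : ℂ)) := by
        rw [← h1]; simpa using hd.hasDerivAt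
      have h5 : HasDerivAt (fun w : ℂ => Complex.I * w) Complex.I ((0 : ℝ) : ℂ) := by
        simpa using (hasDerivAt_id ((0 : ℝ) : ℂ)).const_mul Complex.I
      exact h4.comp _ h5
    have h6 := h3.real_of_complex
    refine h6.congr_deriv ?_
    simp
  have h3 := h2.tendsto_slope_zero_right
  refine neg_nonpos.1 (le_of_tendsto h3 ?_)
  filter_upwards [self_mem_nhdsWithin] with a ha
  have ha' : 0 < a := ha
  have h4 : (L 0 ξ).re = ‖(ξ : H)‖ * ‖(ξ : H)‖ := by
    have := hL.real 0 (ξ : H)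
    rw [Complex.ofReal_zero, T.map_zero_apply] at this
    rw [this]
    exact inner_self_eq_norm_mul_norm (𝕜 := ℂ) _
  simp only [zero_add, Complex.ofReal_zero, mul_zero, h4, smul_eq_mul]
  refine mul_nonpos_of_nonneg_of_nonpos (by positivity) (sub_nonpos.2 ?_)
  exact (Complex.re_le_norm _).trans (hb a ha'.le)

/-- Positivity of the generator from the commutation relations and an invariant dense subspace
of vectors whose `U`-orbits extend to the strip. -/
theorem isPositiveOperator_generator_of_strip
    (hUT : ∀ a t : ℝ, U t * T a * U (-t) = T (Real.exp t * a))
    {D : Submodule ℂ H} (hD : Dense (D : Set H)) (hUD : ∀ (t : ℝ), ∀ x ∈ D, U t x ∈ D)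
    (hTD : ∀ a : ℝ, 0 ≤ a → ∀ x ∈ D, T a x ∈ D)
    (hF : ∀ x ∈ D, ∃ F, U.IsStripExtension x F) : IsPositiveOperator T.generator := by
  intro x
  rw [Complex.le_def]
  refine ⟨?_, (T.im_inner_generator x).symm⟩
  obtain ⟨y, hy1, hy2, hy3⟩ := T.exists_entire_approx x
  have h1 := (Complex.continuous_re.tendsto _).comp (hy1.inner (𝕜 := ℂ) hy2)
  refine ge_of_tendsto' h1 fun n => ?_
  obtain ⟨L, hL⟩ := hy3 n
  exact hL.re_inner_generator_nonneg fun a ha => hL.norm_le_of_strip hUT hD hUD hTD hF ha _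

end OneParameterUnitaryGroup

end

/-! ### Functional calculus: isometry with `L²(μ_x)` and simple functions -/

noncomputable section

variable {H : Type*} [NormedAddCommGroup H] [InnerProductSpace ℂ H] [CompleteSpace H]

namespace SpectralMeasure

variable (E : SpectralMeasure H)

theorem eLpNorm_two (x : H) (g : ℝ → ℂ) :
    eLpNorm g 2 (E.measure x) = (∫⁻ l, ‖g l‖ₑ ^ 2 ∂(E.measure x)) ^ (1 / 2 : ℝ) := by
  rw [eLpNorm_eq_lintegral_rpow_enorm_toReal (by simp) (by simp)]
  simp

theorem enorm_simpleOp (s : SimpleFunc ℝ ℂ) (x : H) :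
    ‖E.simpleOp s x‖ₑ = eLpNorm s 2 (E.measure x) := by
  rw [eLpNorm_two, ← E.enorm_simpleOp_sq s x, ← ENNReal.rpow_natCast, ← ENNReal.rpow_mul]
  simp

theorem enorm_simpleOp_sub (s t : SimpleFunc ℝ ℂ) (x : H) :
    ‖E.simpleOp s x - E.simpleOp t x‖ₑ = eLpNorm (⇑s - ⇑t) 2 (E.measure x) := by
  have e : E.simpleOp s x - E.simpleOp t x = E.simpleOp (s - t) x := by
    rw [simpleOp_sub]; rfl
  rw [e, enorm_simpleOp]
  rfl

theorem enorm_simpleOp_sub_le (s t : SimpleFunc ℝ ℂ) {f : ℝ → ℂ} (hf : Measurable f) (x : H) :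
    ‖E.simpleOp s x - E.simpleOp t x‖ₑ ≤
      eLpNorm (⇑s - f) 2 (E.measure x) + eLpNorm (⇑t - f) 2 (E.measure x) := by
  rw [enorm_simpleOp_sub]
  have : ⇑s - ⇑t = (⇑s - f) - (⇑t - f) := by abel
  rw [this]
  exact eLpNorm_sub_le ((s.measurable.sub hf).aestronglyMeasurable)
    ((t.measurable.sub hf).aestronglyMeasurable) (by norm_num)

theorem eLpNorm_lt_top_of_mem {f : ℝ → ℂ} {hf : Measurable f} {x : H}
    (hx : x ∈ (E.integral f hf).domain) : eLpNorm f 2 (E.measure x) < ⊤ := by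
  rw [eLpNorm_two]
  exact ENNReal.rpow_lt_top_of_nonneg (by norm_num) (ne_of_lt hx)

theorem tendsto_eLpNorm_approx {f : ℝ → ℂ} (hf : Measurable f) {x : H}
    (hx : x ∈ (E.integral f hf).domain) :
    Tendsto (fun n => eLpNorm (⇑(approx f hf n) - f) 2 (E.measure x)) atTop (𝓝 0) := by
  refine SimpleFunc.tendsto_approxOn_Lp_eLpNorm hf (Set.mem_univ 0) (by simp) (by simp) ?_
  simpa using E.eLpNorm_lt_top_of_mem hx

theorem tendsto_simpleOp_approx {f : ℝ → ℂ} (hf : Measurable f) (x : (E.integral f hf).domain) :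
    Tendsto (fun n => E.simpleOp (approx f hf n) (x : H)) atTop (𝓝 (E.integral f hf x)) :=
  tendsto_nhds_limUnder (E.tendsto_approx f hf x x.2)

/-- The Borel functional calculus may be computed with any `L²`-approximation. -/
theorem enorm_simpleOp_sub_integral_le {f : ℝ → ℂ} (hf : Measurable f)
    (x : (E.integral f hf).domain) (s : SimpleFunc ℝ ℂ) :
    ‖E.simpleOp s (x : H) - E.integral f hf x‖ₑ ≤ eLpNorm (⇑s - f) 2 (E.measure (x : H)) := by
  have h1 := (continuous_enorm.tendsto _).comp
    ((E.tendsto_simpleOp_approx hf x).const_sub (E.simpleOp s (x : H)))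
  have h2 := (E.tendsto_eLpNorm_approx hf x.2).const_add (eLpNorm (⇑s - f) 2 (E.measure (x : H)))
  rw [add_zero] at h2
  exact le_of_tendsto_of_tendsto' h1 h2 fun n => E.enorm_simpleOp_sub_le _ _ hf _

theorem tendsto_simpleOp {f : ℝ → ℂ} (hf : Measurable f) (x : (E.integral f hf).domain)
    {s : ℕ → SimpleFunc ℝ ℂ}
    (hs : Tendsto (fun n => eLpNorm (⇑(s n) - f) 2 (E.measure (x : H))) atTop (𝓝 0)) :
    Tendsto (fun n => E.simpleOp (s n) (x : H)) atTop (𝓝 (E.integral f hf x)) := by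
  rw [tendsto_iff_edist_tendsto_0]
  refine tendsto_of_tendsto_of_tendsto_of_le_of_le tendsto_const_nhds hs (fun _ => zero_le) ?_
  intro n
  simp only [edist_eq_enorm_sub]
  exact E.enorm_simpleOp_sub_integral_le hf x (s n)

/-- The identity holds for simple functions; the two triangle inequalities squeeze the norms of the
approximants to the norm of `f`. -/
theorem enorm_integral {f : ℝ → ℂ} (hf : Measurable f) (x : (E.integral f hf).domain) :
    ‖E.integral f hf x‖ₑ = eLpNorm f 2 (E.measure (x : H)) := by
  have h1 := (continuous_enorm.tendsto _).comp (E.tendsto_simpleOp_approx hf x)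
  refine tendsto_nhds_unique h1 ?_
  have h2 := E.tendsto_eLpNorm_approx hf x.2
  have hm : ∀ n, AEStronglyMeasurable (⇑(approx f hf n) - f) (E.measure (x : H)) := fun n =>
    ((approx f hf n).measurable.sub hf).aestronglyMeasurable
  have hsm : ∀ n, AEStronglyMeasurable (⇑(approx f hf n)) (E.measure (x : H)) := fun n =>
    (approx f hf n).measurable.aestronglyMeasurable
  have up : ∀ n, ‖E.simpleOp (approx f hf n) (x : H)‖ₑ ≤
      eLpNorm f 2 (E.measure (x : H)) + eLpNorm (⇑(approx f hf n) - f) 2 (E.measure (x : H)) := by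
    intro n
    rw [enorm_simpleOp]
    have := eLpNorm_add_le (hf.aestronglyMeasurable (μ := E.measure (x : H))) (hm n)
      (p := 2) (by norm_num)
    rwa [add_sub_cancel] at this
  have lo : ∀ n, eLpNorm f 2 (E.measure (x : H)) -
      eLpNorm (⇑(approx f hf n) - f) 2 (E.measure (x : H)) ≤
        ‖E.simpleOp (approx f hf n) (x : H)‖ₑ := by
    intro n
    rw [enorm_simpleOp, tsub_le_iff_right]
    have := eLpNorm_sub_le (hsm n) (hm n) (p := 2) (by norm_num)
    rwa [sub_sub_cancel] at this
  have hup := h2.const_add (eLpNorm f 2 (E.measure (x : H)))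
  have hlo := ENNReal.Tendsto.sub (tendsto_const_nhds (x := eLpNorm f 2 (E.measure (x : H)))) h2
    (Or.inr (by simp))
  rw [add_zero] at hup
  rw [tsub_zero] at hlo
  exact tendsto_of_tendsto_of_tendsto_of_le_of_le hlo hup lo up

theorem measure_univ (x : H) : E.measure x Set.univ = ‖x‖ₑ ^ 2 := by
  rw [E.measure_apply x MeasurableSet.univ, E.univ', ← ofReal_norm,
    ← ENNReal.ofReal_pow (norm_nonneg _)]
  rfl

instance (x : H) : IsFiniteMeasure (E.measure x) :=
  ⟨by rw [measure_univ]; exact ENNReal.pow_lt_top enorm_lt_top⟩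

/-- Dominated convergence in `L²(μ_x)`. -/
theorem tendsto_eLpNorm_zero {x : H} {g : ℕ → ℝ → ℂ} {G : ℝ → ℂ} (hg : ∀ n, Measurable (g n))
    (hG : eLpNorm G 2 (E.measure x) < ⊤) (hle : ∀ n l, ‖g n l‖ ≤ ‖G l‖)
    (hlim : ∀ l, Tendsto (fun n => g n l) atTop (𝓝 0)) :
    Tendsto (fun n => eLpNorm (g n) 2 (E.measure x)) atTop (𝓝 0) := by
  have hG2 : ∫⁻ l, ‖G l‖ₑ ^ 2 ∂(E.measure x) ≠ ⊤ := by
    intro h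
    rw [eLpNorm_two, h] at hG
    simp at hG
  have h1 : Tendsto (fun n => ∫⁻ l, ‖g n l‖ₑ ^ 2 ∂(E.measure x)) atTop
      (𝓝 (∫⁻ _, 0 ∂(E.measure x))) := by
    refine tendsto_lintegral_of_dominated_convergence (fun l => ‖G l‖ₑ ^ 2)
      (fun n => (hg n).enorm.pow_const 2) (fun n => Eventually.of_forall fun l => ?_) hG2
      (Eventually.of_forall fun l => ?_)
    · have := hle n l
      have h : ‖g n l‖ₑ ≤ ‖G l‖ₑ := by
        rw [← ofReal_norm, ← ofReal_norm]; exact ENNReal.ofReal_le_ofReal this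
      dsimp only
      gcongr
    · have := ((continuous_enorm.tendsto _).comp (hlim l))
      have h2 := ((ENNReal.continuous_pow 2).tendsto _).comp this
      simpa using! h2
  rw [lintegral_zero] at h1
  have h2 := ((ENNReal.continuous_rpow_const (y := (1 / 2 : ℝ))).tendsto _).comp h1
  simp only [eLpNorm_two]
  simpa using! h2

section SimpleCalculus

theorem proj_biUnion {s : SimpleFunc ℝ ℝ} (t : Finset ℝ) :
    E.proj (s ⁻¹' t) = ∑ c ∈ t, E.proj (s ⁻¹' {c}) := by
  classical
  induction t using Finset.induction_on with
  | empty => simp [E.proj_empty]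
  | insert a t ha ih =>
    have h1 : s ⁻¹' (↑(insert a t) : Set ℝ) = s ⁻¹' {a} ∪ s ⁻¹' t := by
      rw [Finset.coe_insert, Set.insert_eq, Set.preimage_union]
    rw [Finset.sum_insert ha, h1, E.proj_union (s.measurableSet_preimage _)
      (s.measurableSet_preimage _), ih]
    refine Disjoint.preimage _ ?_
    simpa using ha

/-- The map `g` may merge fibres of `s`; additivity of `E` permits a sum over the range of `s`
regardless. All functions of one `s` are then written over the same projections and can be
multiplied or differentiated termwise. -/
theorem simpleOp_map (s : SimpleFunc ℝ ℝ) (g : ℝ → ℂ) :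
    E.simpleOp (s.map g) = ∑ c ∈ s.range, g c • E.proj (s ⁻¹' {c}) := by
  classical
  rw [simpleOp, SimpleFunc.range_map]
  refine Finset.sum_image' _ fun b hb => ?_
  rw [SimpleFunc.map_preimage_singleton, proj_biUnion, Finset.smul_sum]
  refine Finset.sum_congr rfl fun c hc => ?_
  rw [(Finset.mem_filter.1 hc).2]

theorem simpleOp_map_mul (s : SimpleFunc ℝ ℝ) (g h : ℝ → ℂ) :
    E.simpleOp (s.map g) * E.simpleOp (s.map h) = E.simpleOp (s.map fun c => g c * h c) := by
  simp only [simpleOp_map, Finset.sum_mul_sum]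
  refine Finset.sum_congr rfl fun c hc => ?_
  rw [Finset.sum_eq_single c]
  · rw [smul_mul_smul_comm, ← E.inter' _ _ (s.measurableSet_preimage _)
      (s.measurableSet_preimage _),
      Set.inter_self]
  · intro d _ hd
    rw [smul_mul_smul_comm, ← E.inter' _ _ (s.measurableSet_preimage _)
      (s.measurableSet_preimage _),
      ← Set.preimage_inter, Set.singleton_inter_eq_empty.2 (by simpa using hd.symm),
      Set.preimage_empty, E.proj_empty, smul_zero]
  · exact fun h => absurd hc h

/-- The entire operator-valued function `exp (i z s(E))` for a simple function `s`. -/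
def simpleExp (s : SimpleFunc ℝ ℝ) (z : ℂ) : H →L[ℂ] H :=
  E.simpleOp (s.map fun c : ℝ => Complex.exp (Complex.I * z * c))

theorem simpleExp_hasDerivAt (s : SimpleFunc ℝ ℝ) (z : ℂ) :
    HasDerivAt (E.simpleExp s)
      (E.simpleExp s z * (Complex.I • E.simpleOp (s.map fun c : ℝ => (c : ℂ)))) z := by
  have h1 : E.simpleExp s = fun z => ∑ c ∈ s.range, Complex.exp (Complex.I * z * c) •
      E.proj (s ⁻¹' {c}) := by
    ext1 z
    rw [simpleExp, simpleOp_map]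
  have h2 : E.simpleExp s z * (Complex.I • E.simpleOp (s.map fun c : ℝ => (c : ℂ))) =
      ∑ c ∈ s.range, (Complex.exp (Complex.I * z * c) * (Complex.I * c)) •
        E.proj (s ⁻¹' {c}) := by
    rw [mul_smul_comm, simpleExp, simpleOp_map_mul, simpleOp_map, Finset.smul_sum]
    refine Finset.sum_congr rfl fun c _ => ?_
    rw [smul_smul]
    congr 1
    ring
  rw [h2, h1]
  refine HasDerivAt.fun_sum fun c _ => HasDerivAt.smul_const ?_ _
  have := ((hasDerivAt_id z).const_mul Complex.I).mul_const (c : ℂ)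
  simpa using this.cexp

theorem simpleExp_zero (s : SimpleFunc ℝ ℝ) (x : H) : E.simpleExp s 0 x = x := by
  have h1 : E.simpleExp s 0 = E.proj (s ⁻¹' s.range) := by
    rw [simpleExp, simpleOp_map, proj_biUnion]
    simp
  have h2 : s ⁻¹' (s.range : Set ℝ) = Set.univ := by
    ext l; simp
  rw [h1, h2, E.univ']
  rfl

theorem norm_simpleExp_real (s : SimpleFunc ℝ ℝ) (t : ℝ) (x : H) :
    ‖E.simpleExp s t x‖ = ‖x‖ := by
  have h1 : ‖E.simpleExp s t x‖ₑ ^ 2 = ‖x‖ₑ ^ 2 := by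
    rw [simpleExp, enorm_simpleOp_sq, ← E.measure_univ x, ← lintegral_one]
    refine lintegral_congr fun l => ?_
    have : ‖Complex.exp (Complex.I * t * (s l : ℝ))‖ = 1 := by
      rw [Complex.norm_exp]
      simp
    rw [SimpleFunc.map_apply, ← ofReal_norm, this]
    simp
  rw [← toReal_enorm, ← toReal_enorm]
  congr 1
  exact (ENNReal.pow_right_strictMono two_ne_zero).injective h1

end SimpleCalculus

end SpectralMeasure

end

/-! ### Approximation of the spectral variable, and density of the generator's domain -/

noncomputable section

/-- A simple function equal to `l` rounded down to a multiple of `1 / (n + 1)` for `|l| ≤ n`,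
and zero elsewhere. -/
def roundDown (n : ℕ) : SimpleFunc ℝ ℝ where
  toFun l := if |l| ≤ n then (⌊((n : ℝ) + 1) * l⌋ : ℝ) / (n + 1) else 0
  measurableSet_fiber' c := by
    refine measurableSet_preimage ?_ (measurableSet_singleton c)
    refine Measurable.ite (measurableSet_le (by fun_prop) measurable_const) ?_ measurable_const
    have : Measurable fun l : ℝ => ((⌊((n : ℝ) + 1) * l⌋ : ℤ) : ℝ) :=
      measurable_from_top.comp (Int.measurable_floor.comp (by fun_prop))
    exact this.div_const _
  finite_range' := by
    -- For `|l| ≤ n` the integer `⌊(n + 1) l⌋` lies between `±(n + 1)²`.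
    refine (((Set.finite_Icc (-((n + 1 : ℤ) * (n + 1))) ((n + 1 : ℤ) * (n + 1))).image
      fun k : ℤ => (k : ℝ) / (n + 1)).union (Set.finite_singleton 0)).subset ?_
    rintro _ ⟨l, rfl⟩
    dsimp only
    split_ifs with h
    · left
      refine ⟨⌊((n : ℝ) + 1) * l⌋, ?_, rfl⟩
      have h1 := abs_le.1 h
      have h0 : (0 : ℝ) ≤ n := Nat.cast_nonneg n
      constructor
      · rw [Int.le_floor]
        push_cast
        nlinarith
      · have h2 : (⌊((n : ℝ) + 1) * l⌋ : ℝ) ≤ ((n : ℝ) + 1) * l := Int.floor_le _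
        have h3 : (⌊((n : ℝ) + 1) * l⌋ : ℝ) ≤ (((n + 1 : ℤ) * (n + 1) : ℤ) : ℝ) := by
          push_cast
          nlinarith
        exact_mod_cast h3
    · right; rfl

theorem roundDown_apply (n : ℕ) (l : ℝ) :
    roundDown n l = if |l| ≤ n then (⌊((n : ℝ) + 1) * l⌋ : ℝ) / (n + 1) else 0 := rfl

theorem roundDown_of_lt {n : ℕ} {l : ℝ} (h : ¬ |l| ≤ n) : roundDown n l = 0 := by
  rw [roundDown_apply, if_neg h]

theorem roundDown_le {n : ℕ} {l : ℝ} (h : |l| ≤ n) : roundDown n l ≤ l := by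
  rw [roundDown_apply, if_pos h, div_le_iff₀ (by positivity), mul_comm]
  exact Int.floor_le _

theorem sub_le_roundDown {n : ℕ} {l : ℝ} (h : |l| ≤ n) :
    l - 1 / (n + 1) ≤ roundDown n l := by
  have h0 : (0 : ℝ) < n + 1 := by positivity
  rw [roundDown_apply, if_pos h, le_div_iff₀ h0, sub_mul, one_div_mul_cancel h0.ne', mul_comm]
  exact (Int.sub_one_lt_floor _).le

theorem one_div_add_one_le_one (n : ℕ) : (1 : ℝ) / (n + 1) ≤ 1 := by
  rw [div_le_one (by positivity)]
  linarith [(Nat.cast_nonneg n : (0 : ℝ) ≤ n)]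

theorem abs_roundDown_sub_le {n : ℕ} {l : ℝ} (h : |l| ≤ n) :
    |roundDown n l - l| ≤ 1 / (n + 1) := by
  rw [abs_le]
  have h0 : (0 : ℝ) ≤ 1 / (n + 1) := by positivity
  constructor <;> linarith [roundDown_le h, sub_le_roundDown h]

theorem tendsto_roundDown (l : ℝ) : Tendsto (fun n => roundDown n l) atTop (𝓝 l) := by
  rw [tendsto_iff_dist_tendsto_zero]
  refine squeeze_zero' (Eventually.of_forall fun _ => dist_nonneg) ?_
    (tendsto_one_div_add_atTop_nhds_zero_nat (𝕜 := ℝ))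
  filter_upwards [tendsto_natCast_atTop_atTop.eventually_ge_atTop |l|] with n hn
  rw [Real.dist_eq]
  exact abs_roundDown_sub_le hn

theorem abs_roundDown_sub_le_add (n : ℕ) (l : ℝ) : |roundDown n l - l| ≤ |l| + 1 := by
  by_cases h : |l| ≤ n
  · linarith [abs_roundDown_sub_le h, one_div_add_one_le_one n, abs_nonneg l]
  · rw [roundDown_of_lt h, zero_sub, abs_neg]; linarith

variable {H : Type*} [NormedAddCommGroup H] [InnerProductSpace ℂ H] [CompleteSpace H]

namespace SpectralMeasure

variable (E : SpectralMeasure H)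

theorem eLpNorm_abs_add_one_le (x : H) :
    eLpNorm (fun l : ℝ => ((|l| + 1 : ℝ) : ℂ)) 2 (E.measure x) ≤
      eLpNorm (fun l : ℝ => (l : ℂ)) 2 (E.measure x) + ‖x‖ₑ := by
  have h1 : (fun l : ℝ => ((|l| + 1 : ℝ) : ℂ)) =
      (fun l : ℝ => ((|l| : ℝ) : ℂ)) + fun _ => (1 : ℂ) := by
    ext l; simp
  rw [h1]
  refine (eLpNorm_add_le ?_ ?_ (by norm_num)).trans ?_
  · exact Measurable.aestronglyMeasurable (by fun_prop)
  · exact aestronglyMeasurable_const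
  · refine add_le_add (le_of_eq (eLpNorm_congr_norm_ae (Eventually.of_forall fun l => ?_)))
      (le_of_eq ?_)
    · simp
    · rw [eLpNorm_two]
      simp only [enorm_one, one_pow, lintegral_one, measure_univ]
      rw [← ENNReal.rpow_natCast, ← ENNReal.rpow_mul]
      simp

theorem eLpNorm_roundDown_sub_le (x : H) (n : ℕ) :
    eLpNorm (⇑((roundDown n).map fun c : ℝ => (c : ℂ)) - fun l : ℝ => (l : ℂ)) 2 (E.measure x) ≤
      eLpNorm (fun l : ℝ => (l : ℂ)) 2 (E.measure x) + ‖x‖ₑ := by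
  refine (eLpNorm_mono fun l => ?_).trans (E.eLpNorm_abs_add_one_le x)
  have h1 : ‖((|l| + 1 : ℝ) : ℂ)‖ = |l| + 1 := by
    rw [Complex.norm_real, Real.norm_eq_abs, abs_of_nonneg (by positivity)]
  rw [h1, Pi.sub_apply, SimpleFunc.map_apply, ← Complex.ofReal_sub, Complex.norm_real]
  exact abs_roundDown_sub_le_add n l

theorem tendsto_simpleOp_roundDown
    (x : (E.integral (fun l => (l : ℂ)) Complex.measurable_ofReal).domain) :
    Tendsto (fun n => E.simpleOp ((roundDown n).map fun c : ℝ => (c : ℂ)) (x : H)) atTop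
      (𝓝 (E.integral (fun l => (l : ℂ)) Complex.measurable_ofReal x)) := by
  refine E.tendsto_simpleOp _ x ?_
  refine E.tendsto_eLpNorm_zero (G := fun l : ℝ => ((|l| + 1 : ℝ) : ℂ)) (fun n => ?_) ?_ ?_ ?_
  · exact (SimpleFunc.measurable _).sub Complex.measurable_ofReal
  · exact (E.eLpNorm_abs_add_one_le _).trans_lt
      (ENNReal.add_lt_top.2 ⟨E.eLpNorm_lt_top_of_mem x.2, enorm_lt_top⟩)
  · intro n l
    have h1 : ‖((|l| + 1 : ℝ) : ℂ)‖ = |l| + 1 := by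
      rw [Complex.norm_real, Real.norm_eq_abs, abs_of_nonneg (by positivity)]
    rw [h1, Pi.sub_apply, SimpleFunc.map_apply, ← Complex.ofReal_sub, Complex.norm_real]
    exact abs_roundDown_sub_le_add n l
  · intro l
    have h1 : Tendsto (fun n => ((roundDown n l : ℝ) : ℂ) - (l : ℂ)) atTop (𝓝 0) := by
      have := ((Complex.continuous_ofReal.tendsto l).comp (tendsto_roundDown l)).sub_const (l : ℂ)
      simpa using! this
    exact h1

end SpectralMeasure

namespace OneParameterUnitaryGroup

variable (U : OneParameterUnitaryGroup H)

/-- The averages `∫₀ʰ U(s)x ds` lie in the domain, as translating them only moves the endpoints of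
integration; divided by `h` they tend to `x` as `h → 0⁺`. -/
theorem dense_generator_domain : Dense (U.generator.domain : Set H) := by
  intro x
  have hI : ∀ a b : ℝ, IntervalIntegrable (fun s => U s x) volume a b := fun a b =>
    (U.continuous_apply x).intervalIntegrable a b
  have hd : ∀ h : ℝ, HasDerivAt (fun r : ℝ => ∫ s in (0 : ℝ)..r, U s x) (U h x) h := fun h =>
    intervalIntegral.integral_hasDerivAt_right (hI 0 h)
      ((U.continuous_apply x).stronglyMeasurableAtFilter _ _) (U.continuous_apply x).continuousAt
  have hmem : ∀ h : ℝ, (∫ s in (0 : ℝ)..h, U s x) ∈ U.generator.domain := by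
    intro h
    rw [mem_generator_domain]
    have h1 : (fun t : ℝ => U t (∫ s in (0 : ℝ)..h, U s x)) =
        fun t : ℝ => (∫ s in (0 : ℝ)..(h + t), U s x) - ∫ s in (0 : ℝ)..t, U s x := by
      ext t
      rw [← ContinuousLinearMap.intervalIntegral_comp_comm _ (hI 0 h)]
      simp only [← U.map_add_apply]
      rw [intervalIntegral.integral_comp_add_left (fun s => U s x), add_zero, add_comm t h,
        intervalIntegral.integral_interval_sub_left (hI _ _) (hI _ _)]
    rw [h1]
    refine DifferentiableAt.fun_sub ?_ (hd 0).differentiableAt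
    have h2 : DifferentiableAt ℝ (fun r : ℝ => ∫ s in (0 : ℝ)..r, U s x) (h + 0) :=
      (hd _).differentiableAt
    exact h2.comp (0 : ℝ) (by fun_prop : DifferentiableAt ℝ (fun t : ℝ => h + t) 0)
  have h3 := (hd 0).tendsto_slope_zero_right
  rw [U.map_zero_apply] at h3
  refine mem_closure_of_tendsto h3 (Eventually.of_forall fun t => ?_)
  simp only [zero_add, intervalIntegral.integral_same, sub_zero]
  have h4 := U.generator.domain.smul_mem (t⁻¹ : ℂ) (hmem t)
  rwa [← Complex.ofReal_inv, Complex.coe_smul] at h4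

end OneParameterUnitaryGroup

end

/-! ### The unitary group as an exponential of its generator -/

noncomputable section
variable {H : Type*} [NormedAddCommGroup H] [InnerProductSpace ℂ H] [CompleteSpace H]

namespace SpectralMeasure

variable (E : SpectralMeasure H) {U : OneParameterUnitaryGroup H}

/-- Duhamel's formula comparing `U` with the approximating groups. -/
theorem simpleExp_duhamel (s : SimpleFunc ℝ ℝ) (x : U.generator.domain) (t : ℝ) :
    U t (x : H) - E.simpleExp s t x = ∫ r in (0 : ℝ)..t, E.simpleExp s ((t - r : ℝ) : ℂ)
      (Complex.I • (U r (U.generator x) -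
        E.simpleOp (s.map fun c : ℝ => (c : ℂ)) (U r (x : H)))) := by
  set A : H →L[ℂ] H := E.simpleOp (s.map fun c : ℝ => (c : ℂ))
  have hV : ∀ r : ℝ, HasDerivAt (fun r : ℝ => E.simpleExp s ((t - r : ℝ) : ℂ))
      (-(E.simpleExp s ((t - r : ℝ) : ℂ) * (Complex.I • A))) r := by
    intro r
    have h1 : HasDerivAt (fun r : ℝ => ((t - r : ℝ) : ℂ)) ((-1 : ℝ) : ℂ) r :=
      ((hasDerivAt_id r).const_sub t).ofReal_comp
    have h2 := (E.simpleExp_hasDerivAt s ((t - r : ℝ) : ℂ)).scomp r h1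
    simpa [Function.comp_def] using h2
  have hd : ∀ r : ℝ, HasDerivAt (fun r : ℝ => E.simpleExp s ((t - r : ℝ) : ℂ) (U r (x : H)))
      (E.simpleExp s ((t - r : ℝ) : ℂ)
        (Complex.I • (U r (U.generator x) - A (U r (x : H))))) r := by
    intro r
    have hV' := (ContinuousLinearMap.restrictScalarsL ℂ H H ℝ ℝ).hasFDerivAt.comp_hasDerivAt r
      (hV r)
    have h1 := hV'.clm_apply (U.hasDerivAt_apply x r)
    refine h1.congr_deriv ?_
    simp [smul_sub]
    abel
  have hc : Continuous fun r : ℝ => E.simpleExp s ((t - r : ℝ) : ℂ)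
      (Complex.I • (U r (U.generator x) - A (U r (x : H)))) := by
    have h1 : Continuous fun r : ℝ => E.simpleExp s ((t - r : ℝ) : ℂ) :=
      continuous_iff_continuousAt.2 fun r => (hV r).continuousAt
    have h2 := U.continuous_apply (U.generator x)
    have h3 := U.continuous_apply (x : H)
    exact h1.clm_apply (by fun_prop)
  rw [intervalIntegral.integral_eq_sub_of_hasDerivAt (fun r _ => hd r)
    (hc.intervalIntegrable _ _)]
  simp [simpleExp_zero, U.map_zero_apply]

/-- In Duhamel's formula the unitary factor drops out of the norm of the integrand, leaving `‖K
U(r)x - Aₙ U(r)x‖`. This tends to zero for each `r` because `U(r)` preserves the domain, and the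
bound in `hb` does not depend on `r`, since `U(r)` preserves both `‖x‖` and `‖Kx‖`. -/
theorem tendsto_simpleExp_of_mem
    (hE : E.integral (fun l => (l : ℂ)) Complex.measurable_ofReal = U.generator)
    (x : U.generator.domain) (t : ℝ) :
    Tendsto (fun n => E.simpleExp (roundDown n) t (x : H)) atTop (𝓝 (U t (x : H))) := by
  let A : ℕ → H →L[ℂ] H := fun n => E.simpleOp ((roundDown n).map fun c : ℝ => (c : ℂ))
  have hcomm : ∀ r : ℝ, ∃ h : U r x ∈ U.generator.domain,
      U.generator ⟨U r x, h⟩ = U r (U.generator x) := fun r =>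
    U.generator_apply_of_commute (U r)
      (fun t y => by rw [← U.map_add_apply, ← U.map_add_apply, add_comm]) x
  have hK : ∀ (y : H) (h : y ∈ U.generator.domain),
      ∃ h', E.integral (fun l => (l : ℂ)) Complex.measurable_ofReal ⟨y, h'⟩ =
        U.generator ⟨y, h⟩ := by
    rw [← hE]
    exact fun y h => ⟨h, rfl⟩
  have hb : ∀ n r, ‖U r (U.generator x) - A n (U r (x : H))‖ ≤
      (‖U.generator x‖ₑ + ‖(x : H)‖ₑ).toReal := by
    intro n r
    obtain ⟨h1, h2⟩ := hcomm r
    obtain ⟨h3, h4⟩ := hK _ h1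
    have h5 := (E.enorm_simpleOp_sub_integral_le Complex.measurable_ofReal ⟨_, h3⟩
      ((roundDown n).map fun c : ℝ => (c : ℂ))).trans (E.eLpNorm_roundDown_sub_le _ n)
    have h6 := E.enorm_integral Complex.measurable_ofReal ⟨_, h3⟩
    rw [← h6, h4, h2] at h5
    have h7 : ∀ y : H, ‖U r y‖ₑ = ‖y‖ₑ := fun y => by
      rw [← ofReal_norm, U.norm_apply, ofReal_norm]
    dsimp only at h5
    rw [h7, h7] at h5
    rw [norm_sub_rev, ← toReal_enorm]
    exact ENNReal.toReal_mono (by simp) h5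
  have hlim : ∀ r, Tendsto (fun n => U r (U.generator x) - A n (U r (x : H))) atTop (𝓝 0) := by
    intro r
    obtain ⟨h1, h2⟩ := hcomm r
    obtain ⟨h3, h4⟩ := hK _ h1
    have h5 := (E.tendsto_simpleOp_roundDown ⟨_, h3⟩).const_sub (U r (U.generator x))
    rwa [h4, h2, sub_self] at h5
  have hint : Tendsto (fun n => ∫ r in (0 : ℝ)..t, E.simpleExp (roundDown n) ((t - r : ℝ) : ℂ)
      (Complex.I • (U r (U.generator x) - A n (U r (x : H))))) atTop
      (𝓝 (∫ _ in (0 : ℝ)..t, (0 : H))) := by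
    refine intervalIntegral.tendsto_integral_filter_of_dominated_convergence
      (fun _ => (‖U.generator x‖ₑ + ‖(x : H)‖ₑ).toReal) ?_ ?_ (by simp) ?_
    · refine Eventually.of_forall fun n => Continuous.aestronglyMeasurable ?_
      have h1 : Continuous fun r : ℝ => E.simpleExp (roundDown n) ((t - r : ℝ) : ℂ) := by
        have : Continuous (E.simpleExp (roundDown n)) :=
          continuous_iff_continuousAt.2 fun z => (E.simpleExp_hasDerivAt _ z).continuousAt
        exact this.comp (by fun_prop)
      have h2 := U.continuous_apply (U.generator x)
      have h3 := U.continuous_apply (x : H)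
      exact h1.clm_apply (by fun_prop)
    · refine Eventually.of_forall fun n => Eventually.of_forall fun r _ => ?_
      rw [norm_simpleExp_real, norm_smul, Complex.norm_I, one_mul]
      exact hb n r
    · refine Eventually.of_forall fun r _ => ?_
      rw [tendsto_zero_iff_norm_tendsto_zero]
      simp only [norm_simpleExp_real, norm_smul, Complex.norm_I, one_mul]
      exact tendsto_zero_iff_norm_tendsto_zero.1 (hlim r)
  simp only [A, ← simpleExp_duhamel, intervalIntegral.integral_zero] at hint
  have := hint.const_sub (U t (x : H))
  simpa using this

/-- The unitary group generated by `∫ l dE(l)` is `∫ exp (i t l) dE(l)`. -/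
theorem tendsto_simpleExp
    (hE : E.integral (fun l => (l : ℂ)) Complex.measurable_ofReal = U.generator)
    (x : H) (t : ℝ) :
    Tendsto (fun n => E.simpleExp (roundDown n) t x) atTop (𝓝 (U t x)) := by
  rw [Metric.tendsto_atTop]
  intro ε hε
  -- A three-epsilon argument: both families consist of isometries, so convergence on a dense
  -- subspace suffices.
  obtain ⟨y, hy, hxy⟩ := Metric.dense_iff.1 U.dense_generator_domain x (ε / 3) (by positivity)
  have hd : dist y x < ε / 3 := hy
  obtain ⟨N, hN⟩ := Metric.tendsto_atTop.1 (E.tendsto_simpleExp_of_mem hE ⟨y, hxy⟩ t) (ε / 3)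
    (by positivity)
  refine ⟨N, fun n hn => ?_⟩
  have h1 : dist (E.simpleExp (roundDown n) t x) (E.simpleExp (roundDown n) t y) = dist y x := by
    rw [dist_eq_norm, ← map_sub, norm_simpleExp_real, ← dist_eq_norm, dist_comm]
  have h2 : dist (U t y) (U t x) = dist y x := by
    rw [dist_eq_norm, ← map_sub, U.norm_apply, ← dist_eq_norm]
  have h3 := dist_triangle4 (E.simpleExp (roundDown n) t x) (E.simpleExp (roundDown n) t y)
    (U t y) (U t x)
  have h4 := hN n hn
  dsimp only at h4
  linarith

end SpectralMeasure

end

/-! ### Vectors in the domain of `e^{-πK}` have strip extensions -/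

noncomputable section

/-- A weight dominating `exp (i z c)` for `z` in the strip and `c ≥ l - 1`. -/
def stripWeight (l : ℝ) : ℝ := Real.exp Real.pi * (1 + Real.exp (-(Real.pi * l)))

theorem one_le_stripWeight (l : ℝ) : 1 ≤ stripWeight l := by
  have h1 : 1 ≤ Real.exp Real.pi := Real.one_le_exp Real.pi_pos.le
  have h2 := Real.exp_pos (-(Real.pi * l))
  unfold stripWeight
  nlinarith

/-- The modulus is `e^{-c Im z}`: at most `1` if `c ≥ 0`, and at most `e^{-πc} ≤ e^π e^{-πl}` if `c
≤ 0`. The loss of `1` in `c ≥ l - 1` accounts for the factor `e^π` in the weight. -/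
theorem norm_cexp_strip_le {z : ℂ} (hz : z ∈ closedPiStrip) {c l : ℝ} (h : l - 1 ≤ c) :
    ‖Complex.exp (Complex.I * z * c)‖ ≤ stripWeight l := by
  have h1 : (Complex.I * z * c).re = -(z.im * c) := by simp
  have h2 : 0 ≤ z.im := hz.1
  have h3 : z.im ≤ Real.pi := hz.2
  rw [Complex.norm_exp, h1]
  rcases le_total 0 c with hc | hc
  · exact (Real.exp_le_one_iff.2 (by nlinarith)).trans (one_le_stripWeight l)
  · calc Real.exp (-(z.im * c)) ≤ Real.exp (Real.pi + -(Real.pi * l)) := by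
          apply Real.exp_le_exp.2
          nlinarith [Real.pi_pos]
      _ ≤ stripWeight l := by
          rw [Real.exp_add, stripWeight]
          nlinarith [Real.exp_pos Real.pi]

theorem norm_cexp_sub_cexp_le {z : ℂ} (hz : z ∈ closedPiStrip) {c l : ℝ} (h : l - 1 ≤ c)
    (hcl : c ≤ l) :
    ‖Complex.exp (Complex.I * z * c) - Complex.exp (Complex.I * z * l)‖ ≤
      ‖z‖ * stripWeight l * (l - c) := by
  have hd : ∀ b : ℝ, HasDerivAt (fun b : ℝ => Complex.exp (Complex.I * z * b))
      (Complex.exp (Complex.I * z * b) * (Complex.I * z)) b := by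
    intro b
    have h1 := ((hasDerivAt_id (b : ℂ)).const_mul (Complex.I * z)).comp_ofReal
    simpa using h1.cexp
  have := Convex.norm_image_sub_le_of_norm_hasDerivWithin_le (s := Set.Icc c l)
    (C := ‖z‖ * stripWeight l) (fun b _ => (hd b).hasDerivWithinAt) (fun b hb => ?_)
    (convex_Icc c l) (Set.right_mem_Icc.2 hcl) (Set.left_mem_Icc.2 hcl)
  · rwa [norm_sub_rev c l, Real.norm_eq_abs, abs_of_nonneg (sub_nonneg.2 hcl)] at this
  · rw [norm_mul, norm_mul, Complex.norm_I, one_mul, mul_comm]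
    exact mul_le_mul_of_nonneg_left (norm_cexp_strip_le hz (h.trans hb.1)) (norm_nonneg _)

/-- The error of approximating `exp (i z l)` by rounding `l`, for `‖z‖ ≤ R`. -/
def roundError (R : ℝ) (n : ℕ) (l : ℝ) : ℝ :=
  if |l| ≤ n then R * stripWeight l * (1 / (n + 1)) else 2 * stripWeight l

theorem roundError_nonneg {R : ℝ} (hR : 0 ≤ R) (n : ℕ) (l : ℝ) : 0 ≤ roundError R n l := by
  have := one_le_stripWeight l
  unfold roundError
  split_ifs <;> positivity

theorem roundError_le {R : ℝ} (hR : 0 ≤ R) (n : ℕ) (l : ℝ) :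
    roundError R n l ≤ (R + 2) * stripWeight l := by
  have h := one_le_stripWeight l
  unfold roundError
  split_ifs
  · have := mul_le_mul_of_nonneg_left (one_div_add_one_le_one n)
      (show 0 ≤ R * stripWeight l by positivity)
    nlinarith
  · nlinarith

theorem measurable_stripWeight : Measurable stripWeight := by
  unfold stripWeight
  fun_prop

theorem measurable_roundError (R : ℝ) (n : ℕ) : Measurable (roundError R n) := by
  have := measurable_stripWeight
  refine Measurable.ite (measurableSet_le (by fun_prop) measurable_const) ?_ ?_ <;> fun_prop

theorem tendsto_roundError (R l : ℝ) : Tendsto (fun n => roundError R n l) atTop (𝓝 0) := by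
  have h1 : Tendsto (fun n : ℕ => R * stripWeight l * (1 / ((n : ℝ) + 1))) atTop (𝓝 0) := by
    simpa using (tendsto_one_div_add_atTop_nhds_zero_nat (𝕜 := ℝ)).const_mul (R * stripWeight l)
  refine h1.congr' ?_
  filter_upwards [tendsto_natCast_atTop_atTop.eventually_ge_atTop |l|] with n hn
  rw [roundError, if_pos hn]

theorem norm_cexp_roundDown_sub_le {z : ℂ} (hz : z ∈ closedPiStrip) {R : ℝ} (hR : ‖z‖ ≤ R)
    (n : ℕ) (l : ℝ) :
    ‖Complex.exp (Complex.I * z * (roundDown n l : ℝ)) - Complex.exp (Complex.I * z * l)‖ ≤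
      roundError R n l := by
  have hw := one_le_stripWeight l
  unfold roundError
  split_ifs with h
  · have h1 := sub_le_roundDown h
    have h2 := one_div_add_one_le_one n
    refine (norm_cexp_sub_cexp_le hz (by linarith) (roundDown_le h)).trans ?_
    have h3 : 0 ≤ l - roundDown n l := by linarith [roundDown_le h]
    have h4 : 0 ≤ R := (norm_nonneg z).trans hR
    have h5 : 0 ≤ R * stripWeight l := by positivity
    have h6 : l - roundDown n l ≤ 1 / (n + 1) := by linarith
    gcongr
  -- Beyond the cutoff the rounded value is `0`, so `1` is compared with `e^{izl}`, and both are at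
  -- most the weight.
  · rw [roundDown_of_lt h]
    refine (norm_sub_le _ _).trans ?_
    have := norm_cexp_strip_le hz (show l - 1 ≤ l by linarith)
    simp only [Complex.ofReal_zero, mul_zero, Complex.exp_zero, norm_one]
    linarith

theorem norm_cexp_roundDown_le {z : ℂ} (hz : z ∈ closedPiStrip) (n : ℕ) (l : ℝ) :
    ‖Complex.exp (Complex.I * z * (roundDown n l : ℝ))‖ ≤ stripWeight l := by
  by_cases h : |l| ≤ n
  · exact norm_cexp_strip_le hz (by linarith [sub_le_roundDown h, one_div_add_one_le_one n])
  · rw [roundDown_of_lt h]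
    simpa using one_le_stripWeight l

variable {H : Type*} [NormedAddCommGroup H] [InnerProductSpace ℂ H] [CompleteSpace H]

namespace SpectralMeasure

variable (E : SpectralMeasure H) {U : OneParameterUnitaryGroup H}

theorem eLpNorm_stripWeight_lt_top {x : H}
    (hx : eLpNorm (fun l : ℝ => (Real.exp (-(Real.pi * l)) : ℂ)) 2 (E.measure x) < ⊤) :
    eLpNorm (fun l => (stripWeight l : ℂ)) 2 (E.measure x) < ⊤ := by
  have h1 : (fun l => (stripWeight l : ℂ)) = fun l : ℝ => (Real.exp Real.pi : ℂ) *
      ((1 : ℂ) + (Real.exp (-(Real.pi * l)) : ℂ)) := by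
    ext l
    simp [stripWeight]
  have h2 : MemLp (fun l : ℝ => (Real.exp (-(Real.pi * l)) : ℂ)) 2 (E.measure x) :=
    ⟨Measurable.aestronglyMeasurable (by fun_prop), hx⟩
  have h3 : MemLp (fun _ : ℝ => (1 : ℂ)) 2 (E.measure x) := memLp_const 1
  rw [h1]
  exact ((h3.add h2).const_mul (Real.exp Real.pi : ℂ)).2

/-- The extension is the limit of the entire functions `z ↦ exp (iz sₙ(K)) x`. Their errors are
dominated by `roundError`, uniformly for `z` in bounded parts of the strip, and the `L²(μ_x)` norm
of that error tends to zero. The convergence is therefore locally uniform, and the weight bounds the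
limit on the whole strip. -/
theorem exists_isStripExtension_of_eLpNorm
    (hE : E.integral (fun l => (l : ℂ)) Complex.measurable_ofReal = U.generator) {x : H}
    (hx : eLpNorm (fun l : ℝ => (Real.exp (-(Real.pi * l)) : ℂ)) 2 (E.measure x) < ⊤) :
    ∃ F, U.IsStripExtension x F := by
  let V : ℕ → ℂ → H := fun n z => E.simpleExp (roundDown n) z x
  have hw := E.eLpNorm_stripWeight_lt_top hx
  set W := eLpNorm (fun l => (stripWeight l : ℂ)) 2 (E.measure x)
  let δ : ℝ → ℕ → ENNReal := fun R n => eLpNorm (fun l => (roundError R n l : ℂ)) 2 (E.measure x)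
  have hδ : ∀ R, 0 ≤ R → Tendsto (δ R) atTop (𝓝 0) := by
    intro R hR
    refine E.tendsto_eLpNorm_zero (G := ((R + 2 : ℝ) : ℂ) • fun l => (stripWeight l : ℂ))
      (fun n => ?_) ?_ (fun n l => ?_) fun l => ?_
    · exact Complex.measurable_ofReal.comp (measurable_roundError R n)
    · rw [eLpNorm_const_smul]
      exact ENNReal.mul_lt_top enorm_lt_top hw
    · have h0 := one_le_stripWeight l
      rw [Pi.smul_apply, smul_eq_mul, ← Complex.ofReal_mul, Complex.norm_real, Complex.norm_real,
        Real.norm_eq_abs, Real.norm_eq_abs, abs_of_nonneg (roundError_nonneg hR n l),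
        abs_of_nonneg (by positivity)]
      exact roundError_le hR n l
    · have := (Complex.continuous_ofReal.tendsto 0).comp (tendsto_roundError R l)
      simpa using! this
  have hVm : ∀ z : ℂ, Measurable fun l : ℝ => Complex.exp (Complex.I * z * l) := fun z => by
    fun_prop
  have hVδ : ∀ R z, z ∈ closedPiStrip → ‖z‖ ≤ R → ∀ m n, ‖V m z - V n z‖ₑ ≤ δ R m + δ R n := by
    intro R z hz hR m n
    refine (E.enorm_simpleOp_sub_le _ _ (hVm z) x).trans (add_le_add ?_ ?_)
    · refine eLpNorm_mono fun l => ?_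
      rw [Complex.norm_real]
      exact (norm_cexp_roundDown_sub_le hz hR m l).trans (le_abs_self _)
    · refine eLpNorm_mono fun l => ?_
      rw [Complex.norm_real]
      exact (norm_cexp_roundDown_sub_le hz hR n l).trans (le_abs_self _)
  have hVW : ∀ n, ∀ z ∈ closedPiStrip, ‖V n z‖ₑ ≤ W := by
    intro n z hz
    refine (E.enorm_simpleOp _ x).trans_le (eLpNorm_mono fun l => ?_)
    rw [Complex.norm_real]
    exact (norm_cexp_roundDown_le hz n l).trans (le_abs_self _)
  have hlim : ∀ z, ∃ y, z ∈ closedPiStrip → Tendsto (fun n => V n z) atTop (𝓝 y) := by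
    intro z
    by_cases hz : z ∈ closedPiStrip
    · suffices CauchySeq fun n => V n z by
        obtain ⟨y, hy⟩ := cauchySeq_tendsto_of_complete this
        exact ⟨y, fun _ => hy⟩
      rw [EMetric.cauchySeq_iff]
      intro ε hε
      obtain ⟨N, hN⟩ := eventually_atTop.1 ((hδ ‖z‖ (norm_nonneg _)).eventually
        (gt_mem_nhds (ENNReal.half_pos hε.ne')))
      refine ⟨N, fun m hm n hn => ?_⟩
      rw [edist_eq_enorm_sub]
      calc _ ≤ δ ‖z‖ m + δ ‖z‖ n := hVδ _ z hz le_rfl m n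
        _ < ε / 2 + ε / 2 := ENNReal.add_lt_add (hN m hm) (hN n hn)
        _ = ε := ENNReal.add_halves ε
    · exact ⟨0, fun h => absurd h hz⟩
  choose F hF using hlim
  have hFδ : ∀ R z, 0 ≤ R → z ∈ closedPiStrip → ‖z‖ ≤ R → ∀ m, ‖V m z - F z‖ₑ ≤ δ R m := by
    intro R z hR0 hz hR m
    have h1 := (continuous_enorm.tendsto _).comp ((hF z hz).const_sub (V m z))
    have h2 := (hδ R hR0).const_add (δ R m)
    rw [add_zero] at h2
    exact le_of_tendsto_of_tendsto' h1 h2 fun n => hVδ R z hz hR m n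
  have hunif : TendstoLocallyUniformlyOn V F atTop closedPiStrip := by
    rw [EMetric.tendstoLocallyUniformlyOn_iff]
    intro ε hε z hz
    refine ⟨Metric.ball z 1 ∩ closedPiStrip, inter_mem (mem_nhdsWithin_of_mem_nhds
      (Metric.ball_mem_nhds z one_pos)) self_mem_nhdsWithin, ?_⟩
    filter_upwards [(hδ (‖z‖ + 1) (by positivity)).eventually (gt_mem_nhds hε)] with n hn w hw
    rw [edist_comm, edist_eq_enorm_sub]
    refine (hFδ (‖z‖ + 1) w (by positivity) hw.2 ?_ n).trans_lt hn
    have h1 : ‖w - z‖ < 1 := by simpa [dist_eq_norm] using hw.1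
    have h2 := norm_add_le (w - z) z
    rw [sub_add_cancel] at h2
    linarith
  have hVd : ∀ n, Differentiable ℂ (V n) := fun n z =>
    (E.simpleExp_hasDerivAt (roundDown n) z).differentiableAt.clm_apply (differentiableAt_const x)
  refine ⟨F, diffContOnCl_piStrip ?_ ?_, ⟨W.toReal, fun z hz => ?_⟩, fun t => ?_⟩
  · exact (hunif.mono piStrip_subset_closedPiStrip).differentiableOn
      (Eventually.of_forall fun n => (hVd n).differentiableOn) isOpen_piStrip
  · exact hunif.continuousOn
      (Eventually.of_forall fun n => (hVd n).continuous.continuousOn).frequently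
  · have h1 := le_of_tendsto' ((continuous_enorm.tendsto _).comp (hF z hz)) fun n => hVW n z hz
    rw [← toReal_enorm]
    exact ENNReal.toReal_mono hw.ne h1
  · exact tendsto_nhds_unique
      (hF t (OneParameterUnitaryGroup.real_mem_closedPiStrip t)) (E.tendsto_simpleExp hE x t)

end SpectralMeasure

end

/-! ### The domain of `e^{-βK}`, and weak density -/

noncomputable section

variable {H : Type*} [NormedAddCommGroup H] [InnerProductSpace ℂ H] [CompleteSpace H]

section Domain

/-- Makes the spectral theorem unnecessary: if no spectral measure exists, the operator is `⊥`,
whose domain contains only zero, and the domain arguments below become trivial. -/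
theorem expNeg_cases (β : ℝ) (K : H →ₗ.[ℂ] H) :
    (∃ E : SpectralMeasure H, E.integral (fun l => (l : ℂ)) Complex.measurable_ofReal = K ∧
      expNeg β K = E.integral (fun l => (Real.exp (-(β * l)) : ℂ)) (by fun_prop)) ∨
    expNeg β K = ⊥ := by
  unfold expNeg borelCalculus
  split_ifs with h
  · exact Or.inl ⟨h.choose, h.choose_spec, rfl⟩
  · exact Or.inr rfl

theorem exists_isStripExtension_of_mem_domain {U : OneParameterUnitaryGroup H} {x : H}
    (hx : x ∈ (expNeg Real.pi U.generator).domain) : ∃ F, U.IsStripExtension x F := by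
  rcases expNeg_cases Real.pi U.generator with ⟨E, hE, h⟩ | h
  · rw [h] at hx
    exact E.exists_isStripExtension_of_eLpNorm hE (E.eLpNorm_lt_top_of_mem hx)
  · rw [h] at hx
    have h0 : x = 0 := (Submodule.mem_bot ℂ).1 hx
    rw [h0]
    exact ⟨0, OneParameterUnitaryGroup.IsStripExtension.zero⟩

/-- A Fatou lemma for varying measures. The measures converge on each Borel set, so integrals of
simple functions below `φ` converge; their supremum gives the integral of `φ`. Finiteness of `φ`
keeps the coefficients finite, so that multiplication by them is continuous. -/
theorem SpectralMeasure.lintegral_le_of_tendsto (E : SpectralMeasure H) {φ : ℝ → ENNReal}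
    (hφ : ∀ l, φ l ≠ ⊤) {x : ℕ → H} {y : H} (hx : Tendsto x atTop (𝓝 y)) {C : ENNReal}
    (hC : ∀ n, ∫⁻ l, φ l ∂(E.measure (x n)) ≤ C) : ∫⁻ l, φ l ∂(E.measure y) ≤ C := by
  have hm : ∀ s, MeasurableSet s →
      Tendsto (fun n => E.measure (x n) s) atTop (𝓝 (E.measure y s)) := by
    intro s hs
    simp only [E.measure_apply _ hs]
    exact ENNReal.tendsto_ofReal ((((E.proj s).continuous.tendsto y).comp hx).norm.pow 2)
  rw [lintegral_def]
  refine iSup₂_le fun g hg => ?_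
  have h1 : Tendsto (fun n => g.lintegral (E.measure (x n))) atTop
      (𝓝 (g.lintegral (E.measure y))) := by
    simp only [SimpleFunc.lintegral]
    refine tendsto_finsetSum _ fun c hc => ?_
    refine ENNReal.Tendsto.const_mul (hm _ (g.measurableSet_preimage _)) (Or.inr ?_)
    obtain ⟨l, rfl⟩ := SimpleFunc.mem_range.1 hc
    exact ne_top_of_le_ne_top (hφ l) (hg l)
  refine le_of_tendsto' h1 fun n => ?_
  refine le_trans ?_ (hC n)
  rw [← SimpleFunc.lintegral_eq_lintegral]
  exact lintegral_mono hg

/-- A limit of vectors in the domain of `exp (-β K)` with bounded images is in the domain. -/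
theorem mem_domain_expNeg_of_tendsto {β : ℝ} {K : H →ₗ.[ℂ] H} {x : ℕ → (expNeg β K).domain}
    {y : H} (hx : Tendsto (fun n => (x n : H)) atTop (𝓝 y)) {C : ℝ}
    (hC : ∀ n, ‖expNeg β K (x n)‖ ≤ C) : y ∈ (expNeg β K).domain := by
  rcases expNeg_cases β K with ⟨E, -, h⟩ | h
  · revert x
    rw [h]
    intro x hx hC
    have h1 : ∀ n, ∫⁻ l, ‖(Real.exp (-(β * l)) : ℂ)‖ₑ ^ 2 ∂(E.measure (x n : H)) ≤
        ENNReal.ofReal C ^ 2 := by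
      intro n
      have h2 := E.enorm_integral (by fun_prop) (x n)
      rw [SpectralMeasure.eLpNorm_two] at h2
      have h3 := congrArg (· ^ 2) h2
      simp only [← ENNReal.rpow_natCast, ← ENNReal.rpow_mul] at h3
      norm_num at h3
      simp only [Complex.ofReal_exp]
      push_cast
      rw [← h3]
      gcongr
      rw [← ofReal_norm]
      exact ENNReal.ofReal_le_ofReal (hC n)
    refine (E.lintegral_le_of_tendsto (fun l => ?_) hx h1).trans_lt ?_
    · exact (ENNReal.pow_lt_top enorm_lt_top).ne
    · exact ENNReal.pow_lt_top ENNReal.ofReal_lt_top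
  · revert x
    rw [h]
    intro x hx _
    have h0 : ∀ n, (x n : H) = 0 := fun n => (Submodule.mem_bot ℂ).1 (x n).2
    simp only [h0] at hx
    rw [tendsto_nhds_unique hx tendsto_const_nhds]
    exact Submodule.zero_mem _

end Domain

section Density

theorem continuous_inner_wot (y x : H) :
    Continuous fun A : H →WOT[ℂ] H => (inner ℂ y (A x) : ℂ) :=
  (ContinuousLinearMapWOT.continuous_iff.1 continuous_id) x y

/-- For `y ⊥ BΩ`, the weakly continuous functional `A ↦ ⟨y, AΩ⟩` vanishes on `B`, hence on `M`, and
cyclicity forces `y = 0`. -/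
theorem IsWeaklyDense.dense_orbit {B M : Set (H →L[ℂ] H)} (hB : IsWeaklyDense B M) {Ω : H}
    (hΩ : IsCyclicVector M Ω) :
    Dense ((Submodule.span ℂ ((fun X : H →L[ℂ] H => X Ω) '' B) : Submodule ℂ H) : Set H) := by
  rw [IsCyclicVector] at hΩ
  rw [Submodule.dense_iff_topologicalClosure_eq_top, Submodule.topologicalClosure_eq_top_iff,
    Submodule.eq_bot_iff] at hΩ ⊢
  intro y hy
  refine hΩ y ((Submodule.mem_orthogonal' _ _).2 fun u hu => ?_)
  have h1 : ∀ X ∈ M, inner ℂ y (X Ω) = 0 := by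
    intro X hX
    have hcl : IsClosed {A : H →WOT[ℂ] H | (inner ℂ y (A Ω) : ℂ) = 0} :=
      isClosed_eq (continuous_inner_wot y Ω) continuous_const
    refine closure_minimal ?_ hcl (hB.2 X hX)
    rintro _ ⟨Y, hY, rfl⟩
    exact (Submodule.mem_orthogonal' _ _).1 hy _ (Submodule.subset_span ⟨Y, hY, rfl⟩)
  induction hu using Submodule.span_induction with
  | mem u hu => obtain ⟨X, hX, rfl⟩ := hu; exact h1 X hX
  | zero => simp
  | add u v _ _ hu hv => rw [inner_add_right, hu, hv, add_zero]
  | smul c u _ hu => rw [inner_smul_right, hu, mul_zero]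

/-- The pairs `(Yv, Yw)` with `Y` self-adjoint in `B` form a convex set, so failure of norm
approximation gives a separating functional by Hahn–Banach. That functional is weakly continuous in
`Y`, contradicting weak density. Two vectors are handled together because the Kaplansky estimate
tests `Y - X` on two. -/
theorem exists_selfAdjoint_approx {B : NonUnitalStarSubalgebra ℂ (H →L[ℂ] H)}
    {M : Set (H →L[ℂ] H)} (hB : IsWeaklyDense (B : Set (H →L[ℂ] H)) M) {X : H →L[ℂ] H}
    (hX : X ∈ M) (hXs : IsSelfAdjoint X) (v w : H) {ε : ℝ} (hε : 0 < ε) :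
    ∃ Y ∈ B, IsSelfAdjoint Y ∧ ‖(Y - X) v‖ < ε ∧ ‖(Y - X) w‖ < ε := by
  let S : Set (H × H) := (fun Y : H →L[ℂ] H => (Y v, Y w)) '' {Y | Y ∈ B ∧ IsSelfAdjoint Y}
  have hS : Convex ℝ S := by
    rintro _ ⟨Y, ⟨hY, hYs⟩, rfl⟩ _ ⟨Z, ⟨hZ, hZs⟩, rfl⟩ a b _ _ _
    refine ⟨(a : ℂ) • Y + (b : ℂ) • Z, ⟨add_mem (SMulMemClass.smul_mem _ hY)
      (SMulMemClass.smul_mem _ hZ), ?_⟩, by simp⟩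
    refine IsSelfAdjoint.add ?_ ?_
    · exact IsSelfAdjoint.smul (Complex.conj_ofReal a) hYs
    · exact IsSelfAdjoint.smul (Complex.conj_ofReal b) hZs
  suffices h : (X v, X w) ∈ closure S by
    obtain ⟨_, ⟨Y, ⟨hY, hYs⟩, rfl⟩, hd⟩ := Metric.mem_closure_iff.1 h ε hε
    rw [Prod.dist_eq, max_lt_iff, dist_comm, dist_eq_norm, dist_comm, dist_eq_norm] at hd
    exact ⟨Y, hY, hYs, hd.1, hd.2⟩
  by_contra h
  obtain ⟨f, u, h1, h2⟩ := RCLike.geometric_hahn_banach_closed_point (𝕜 := ℂ) hS.closure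
    isClosed_closure h
  let a := (InnerProductSpace.toDual ℂ H).symm (f.comp (ContinuousLinearMap.inl ℂ H H))
  let b := (InnerProductSpace.toDual ℂ H).symm (f.comp (ContinuousLinearMap.inr ℂ H H))
  have hf : ∀ p q : H, f (p, q) = inner ℂ a p + inner ℂ b q := by
    intro p q
    have h3 : (p, q) = ContinuousLinearMap.inl ℂ H H p + ContinuousLinearMap.inr ℂ H H q := by
      simp
    rw [h3, map_add, InnerProductSpace.toDual_symm_apply, InnerProductSpace.toDual_symm_apply]
    rfl
  -- Averages the separating functional over `A` and `A*`. This is weakly continuous; at an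
  -- arbitrary `Y ∈ B` it is the value at the self-adjoint part of `Y`, which also lies in `B`, and
  -- at the self-adjoint `X` nothing changes.
  let g : (H →WOT[ℂ] H) → ℝ := fun A =>
    ((inner ℂ a (A v) + inner ℂ (A a) v) / 2 + (inner ℂ b (A w) + inner ℂ (A b) w) / 2 : ℂ).re
  have hinv : ∀ p q : H, Continuous fun A : H →WOT[ℂ] H => (inner ℂ (A p) q : ℂ) := fun p q => by
    have := Complex.continuous_conj.comp (continuous_inner_wot q p)
    simpa only [Function.comp_def, inner_conj_symm] using this
  have hg : Continuous g := by
    have h3 := continuous_inner_wot a v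
    have h4 := continuous_inner_wot b w
    have h5 := hinv a v
    have h6 := hinv b w
    exact Complex.continuous_re.comp (by fun_prop)
  have hadj : ∀ (A : H →L[ℂ] H) (p q : H), inner ℂ (A p) q = inner ℂ p ((star A) q) := by
    intro A p q
    rw [ContinuousLinearMap.star_eq_adjoint, ContinuousLinearMap.adjoint_inner_right]
  have hgle : ContinuousLinearMapWOT.ofCLM X ∈ {A | g A ≤ u} := by
    refine closure_minimal ?_ (isClosed_le hg continuous_const) (hB.2 X hX)
    rintro _ ⟨Y, hY, rfl⟩
    let Z : H →L[ℂ] H := (1 / 2 : ℂ) • (Y + star Y)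
    have hZ : Z ∈ B := SMulMemClass.smul_mem _ (add_mem hY (star_mem hY))
    have hZs : IsSelfAdjoint Z := by
      refine IsSelfAdjoint.smul ?_ (IsSelfAdjoint.add_star_self Y)
      simp [IsSelfAdjoint]
    have h3 := h1 _ (subset_closure ⟨Z, ⟨hZ, hZs⟩, rfl⟩)
    rw [hf] at h3
    have h4 : g (ContinuousLinearMapWOT.ofCLM Y) = (inner ℂ a (Z v) + inner ℂ b (Z w) : ℂ).re := by
      simp only [g, ContinuousLinearMapWOT.ofCLM_apply, hadj, Z, FunLike.coe_smul, Pi.smul_apply,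
        FunLike.coe_add, Pi.add_apply, inner_smul_right, inner_add_right]
      congr 1
      ring
    exact (h4.trans_lt h3).le
  have h5 : g (ContinuousLinearMapWOT.ofCLM X) = (f (X v, X w)).re := by
    rw [hf]
    simp only [g, ContinuousLinearMapWOT.ofCLM_apply, hadj, hXs.star_eq]
    congr 1
    ring
  have h6 : g (ContinuousLinearMapWOT.ofCLM X) ≤ u := hgle
  rw [h5] at h6
  exact absurd h2 (not_lt.2 h6)

end Density

end

/-! ### Kaplansky density and the extension of `π`-boundedness to `M` -/

noncomputable section

variable {H : Type*} [NormedAddCommGroup H] [InnerProductSpace ℂ H] [CompleteSpace H]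

section Kaplansky

theorem one_add_sq_pos (x : ℝ) : 0 < 1 + x ^ 2 := by positivity

theorem continuous_inv_one_add_sq : Continuous fun x : ℝ => (1 + x ^ 2)⁻¹ :=
  Continuous.inv₀ (by fun_prop) fun x => (one_add_sq_pos x).ne'

/-- The bounded functions `1 / (1 + A²)` and `A / (1 + A²)` of a self-adjoint operator. -/
theorem exists_bounded_transform (B : NonUnitalStarSubalgebra ℂ (H →L[ℂ] H)) {A : H →L[ℂ] H}
    (hA : A ∈ B) (hAs : IsSelfAdjoint A) :
    ∃ R W : H →L[ℂ] H, W ∈ B.topologicalClosure ∧ R * (1 + A * A) = 1 ∧ W = R * A ∧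
      ‖R‖ ≤ 1 ∧ ‖W‖ ≤ 1 / 2 := by
  have hc := continuous_inv_one_add_sq
  have hc2 : Continuous fun x : ℝ => (1 + x ^ 2)⁻¹ * x := hc.mul continuous_id
  have h1 : cfc (fun x : ℝ => 1 + x ^ 2) A = 1 + A * A := by
    rw [cfc_const_add (1 : ℝ) (fun x => x ^ 2) A, cfc_pow_id (R := ℝ) A 2, map_one, pow_two]
  refine ⟨cfc (fun x : ℝ => (1 + x ^ 2)⁻¹) A, cfc (fun x : ℝ => (1 + x ^ 2)⁻¹ * x) A,
    ?_, ?_, ?_, ?_, ?_⟩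
  -- The function `x / (1 + x²)` vanishes at `0`, so the non-unital calculus keeps it in the norm
  -- closure of `B` even if `B` has no unit.
  · rw [← cfcₙ_eq_cfc (hf := hc2.continuousOn) (hf0 := by simp)]
    have : IsClosed (B.topologicalClosure : Set (H →L[ℂ] H)) :=
      B.isClosed_topologicalClosure
    exact cfcₙ_mem (𝕜 := ℝ) _ (B.le_topologicalClosure hA)
  · rw [← h1, ← cfc_mul _ _ A hc.continuousOn (by fun_prop), ← cfc_one ℝ A]
    refine cfc_congr fun x _ => ?_
    exact inv_mul_cancel₀ (one_add_sq_pos x).ne'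
  · rw [cfc_mul _ _ A hc.continuousOn (by fun_prop), cfc_id' ℝ A]
  · refine norm_cfc_le zero_le_one fun x _ => ?_
    rw [Real.norm_eq_abs, abs_inv, abs_of_pos (one_add_sq_pos x)]
    exact inv_le_one_of_one_le₀ (by nlinarith [sq_nonneg x])
  · refine norm_cfc_le (by norm_num) fun x _ => ?_
    rw [Real.norm_eq_abs, abs_mul, abs_inv, abs_of_pos (one_add_sq_pos x), inv_mul_le_iff₀
      (one_add_sq_pos x)]
    nlinarith [sq_nonneg (|x| - 1), sq_abs x]

/-- Inverting `A ↦ A / (1 + A²)` on self-adjoint operators of small norm. -/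
theorem exists_inverse_transform (M : VonNeumannAlgebra H) {W : H →L[ℂ] H} (hW : W ∈ M)
    (hWs : IsSelfAdjoint W) (hn : ‖W‖ ≤ 1 / 4) :
    ∃ Y ∈ M, IsSelfAdjoint Y ∧ (1 + Y * Y) * W = Y := by
  -- The root `(1 - √(1 - 4w²)) / (2w)` of `w y² - y + w = 0`, rationalized so that it is continuous
  -- at `w = 0`.
  let h : ℝ → ℝ := fun w => 2 * w * (1 + √(1 - 4 * w ^ 2))⁻¹
  have hpos : ∀ w : ℝ, 0 < 1 + √(1 - 4 * w ^ 2) := fun w => by positivity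
  have hc : Continuous h :=
    (by fun_prop : Continuous fun w : ℝ => 2 * w).mul
      (Continuous.inv₀ (by fun_prop) fun w => (hpos w).ne')
  refine ⟨cfc h W, ?_, cfc_predicate h W, ?_⟩
  · rw [← M.commutant_commutant, VonNeumannAlgebra.mem_commutant_iff]
    intro g hg
    rw [VonNeumannAlgebra.mem_commutant_iff] at hg
    have h1 : Commute W g := hg W hW
    exact (Commute.cfc_real h1 h).symm
  · have h1 : cfc (fun x : ℝ => 1 + h x * h x) W = 1 + cfc h W * cfc h W := by
      rw [cfc_const_add (1 : ℝ) (fun x => h x * h x) W (by fun_prop), cfc_mul h h W hc.continuousOn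
        hc.continuousOn, map_one]
    have h2 : (1 + cfc h W * cfc h W) * W = cfc (fun x : ℝ => (1 + h x * h x) * x) W := by
      rw [cfc_mul (fun x : ℝ => 1 + h x * h x) (fun x => x) W (by fun_prop) (by fun_prop),
        h1, cfc_id' ℝ W]
    rw [h2]
    refine cfc_congr fun w hw => ?_
    have h3 : |w| ≤ 1 / 4 := by
      calc |w| ≤ ‖W‖ * ‖(1 : H →L[ℂ] H)‖ := spectrum.norm_le_norm_mul_of_mem hw
        _ ≤ ‖W‖ * 1 := by gcongr; exact ContinuousLinearMap.norm_id_le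
        _ ≤ 1 / 4 := by rwa [mul_one]
    have h4 : 0 ≤ 1 - 4 * w ^ 2 := by
      nlinarith [sq_abs w, abs_nonneg w]
    have h5 := Real.sq_sqrt h4
    have h6 := (hpos w).ne'
    simp only [h]
    set r := √(1 - 4 * w ^ 2)
    field_simp
    linear_combination w * h5

/-- A form of the Kaplansky density theorem. -/
theorem exists_bounded_approx (M : VonNeumannAlgebra H)
    {B : NonUnitalStarSubalgebra ℂ (H →L[ℂ] H)}
    (hB : IsWeaklyDense (B : Set (H →L[ℂ] H)) (M : Set (H →L[ℂ] H))) {W : H →L[ℂ] H} (hW : W ∈ M)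
    (hWs : IsSelfAdjoint W) (hn : ‖W‖ ≤ 1 / 4) (x : H) {ε : ℝ} (hε : 0 < ε) :
    ∃ Z ∈ B, ‖Z‖ ≤ 1 ∧ ‖Z x - W x‖ < ε := by
  obtain ⟨Y, hY, hYs, hYW⟩ := exists_inverse_transform M hW hWs hn
  obtain ⟨A, hA, hAs, h1, h2⟩ := exists_selfAdjoint_approx hB hY hYs ((1 - Y * W) x) (W x)
    (ε := ε / 3) (by positivity)
  obtain ⟨R, V, hV, hR1, hVR, hRn, hVn⟩ := exists_bounded_transform B hA hAs
  -- The standard expansion of `f(A) - f(Y)` for `f(x) = x / (1 + x²)`, with `1 - Y W` standing for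
  -- `(1 + Y²)⁻¹`. The differences `A - Y` act on the fixed vectors `(1 - Y W) x` and `W x`, while
  -- the factors depending on `A` are bounded by `1` and `1/2`.
  have key : V - W = R * ((A - Y) * (1 - Y * W)) - V * ((A - Y) * W) := by
    have e1 : V - W = R * (A - (1 + A * A) * W) := by
      rw [mul_sub, ← hVR, ← mul_assoc, hR1, one_mul]
    have e2 : A - (1 + A * A) * W = (A - Y) * (1 - Y * W) - A * ((A - Y) * W) := by
      have e3 : Y = W + Y * (Y * W) := by
        conv_lhs => rw [← hYW]
        noncomm_ring
      have e4 : (A - Y) * (1 - Y * W) - A * ((A - Y) * W) =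
          A - A * (A * W) - (Y - Y * (Y * W)) := by noncomm_ring
      have e5 : Y - Y * (Y * W) = W := by
        rw [sub_eq_iff_eq_add]; exact e3
      rw [e4, e5]
      noncomm_ring
    rw [e1, e2, mul_sub, ← mul_assoc R A, ← hVR]
  have hVW : ‖V x - W x‖ < 2 * ε / 3 := by
    have e : V x - W x = R ((A - Y) ((1 - Y * W) x)) - V ((A - Y) (W x)) := by
      have := congrArg (fun T : H →L[ℂ] H => T x) key
      simpa only [FunLike.coe_sub, Pi.sub_apply, mul_apply_eq_comp] using! this
    rw [e]
    calc _ ≤ ‖R ((A - Y) ((1 - Y * W) x))‖ + ‖V ((A - Y) (W x))‖ := norm_sub_le _ _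
      _ ≤ 1 * ‖(A - Y) ((1 - Y * W) x)‖ + 1 / 2 * ‖(A - Y) (W x)‖ :=
        add_le_add (R.le_of_opNorm_le hRn _) (V.le_of_opNorm_le hVn _)
      _ < 2 * ε / 3 := by linarith
  -- `V` is only in the norm closure of `B`. The slack between `‖V‖ ≤ 1/2` and `1` pays for the
  -- passage to `Z ∈ B`.
  obtain ⟨Z, hZ, hd⟩ := Metric.mem_closure_iff.1 (show V ∈ closure (B : Set (H →L[ℂ] H)) from hV)
    (min (1 / 2) (ε / 3 / (‖x‖ + 1))) (by positivity)
  rw [lt_min_iff, dist_comm, dist_eq_norm] at hd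
  refine ⟨Z, hZ, ?_, ?_⟩
  · have := norm_add_le (Z - V) V
    rw [sub_add_cancel] at this
    linarith [hd.1]
  · have e : Z x - W x = (Z - V) x + (V x - W x) := by simp
    have h3 : ‖(Z - V) x‖ ≤ ε / 3 := by
      refine ((Z - V).le_of_opNorm_le hd.2.le x).trans ?_
      rw [div_mul_eq_mul_div, div_le_iff₀ (by positivity)]
      have : 0 ≤ ε / 3 := by positivity
      nlinarith
    rw [e]
    exact (norm_add_le _ _).trans_lt (by linarith)

end Kaplansky

theorem VonNeumannAlgebra.complex_smul_mem (M : VonNeumannAlgebra H) (c : ℂ) {X : H →L[ℂ] H}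
    (hX : X ∈ M) : c • X ∈ M :=
  M.toStarSubalgebra.toSubalgebra.smul_mem hX c

theorem VonNeumannAlgebra.induction_selfAdjoint (M : VonNeumannAlgebra H)
    {D : Submodule ℂ (H →L[ℂ] H)}
    (h : ∀ W ∈ M, IsSelfAdjoint W → ‖W‖ ≤ 1 / 4 → W ∈ D) {X : H →L[ℂ] H} (hX : X ∈ M) : X ∈ D := by
  have h1 : ∀ W ∈ M, IsSelfAdjoint W → W ∈ D := by
    intro W hW hWs
    have hr : (0 : ℝ) < 4 * (‖W‖ + 1) := by positivity
    have h2 : (((4 * (‖W‖ + 1))⁻¹ : ℝ) : ℂ) • W ∈ D := by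
      refine h _ (M.complex_smul_mem _ hW) (IsSelfAdjoint.smul (Complex.conj_ofReal _) hWs) ?_
      rw [norm_smul, Complex.norm_real, Real.norm_eq_abs, abs_of_pos (inv_pos.2 hr),
        inv_mul_le_iff₀ hr]
      linarith
    have h3 := D.smul_mem ((4 * (‖W‖ + 1) : ℝ) : ℂ) h2
    rwa [smul_smul, ← Complex.ofReal_mul, mul_inv_cancel₀ hr.ne', Complex.ofReal_one,
      one_smul] at h3
  have hre : (realPart X : H →L[ℂ] H) ∈ M := by
    rw [realPart_apply_coe, ← Complex.coe_smul]
    exact M.complex_smul_mem _ (add_mem hX (star_mem hX))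
  have him : (imaginaryPart X : H →L[ℂ] H) ∈ M := by
    rw [imaginaryPart_apply_coe, ← Complex.coe_smul]
    exact M.complex_smul_mem _ (M.complex_smul_mem _ (sub_mem hX (star_mem hX)))
  rw [← realPart_add_I_smul_imaginaryPart X]
  exact D.add_mem (h1 _ hre (realPart X).2) (D.smul_mem _ (h1 _ him (imaginaryPart X).2))

/-- Approximants from the unit ball of `B` have images under `e^{-βK}` bounded by `|C|`, so the
limit vector stays in the domain. Linearity in `X` reduces `M` to its self-adjoint elements of small
norm. -/
theorem mem_domain_of_isBetaBounded (M : VonNeumannAlgebra H)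
    {B : NonUnitalStarSubalgebra ℂ (H →L[ℂ] H)}
    (hB : IsWeaklyDense (B : Set (H →L[ℂ] H)) (M : Set (H →L[ℂ] H))) {β : ℝ} {K : H →ₗ.[ℂ] H}
    {Ω : H} (h : IsBetaBounded β K Ω B.toNonUnitalSubalgebra.toSubmodule) {X : H →L[ℂ] H}
    (hX : X ∈ M) : X Ω ∈ (expNeg β K).domain := by
  obtain ⟨hdom, C, hC⟩ := h
  refine M.induction_selfAdjoint (D := (expNeg β K).domain.comap
    (ContinuousLinearMap.apply ℂ H Ω).toLinearMap) (fun W hW hWs hn => ?_) hX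
  choose Z hZB hZ1 hZ2 using fun n : ℕ => exists_bounded_approx M hB hW hWs hn Ω
    (show (0 : ℝ) < 1 / (n + 1) by positivity)
  refine mem_domain_expNeg_of_tendsto (x := fun n => ⟨Z n Ω, hdom _ (hZB n)⟩) (C := |C|)
    (y := W Ω) ?_ fun n => ?_
  · rw [tendsto_iff_norm_sub_tendsto_zero]
    exact squeeze_zero (fun _ => norm_nonneg _) (fun n => (hZ2 n).le)
      (tendsto_one_div_add_atTop_nhds_zero_nat (𝕜 := ℝ))
  · refine (hC _ (hZB n)).trans ?_
    calc C * ‖Z n‖ ≤ |C| * ‖Z n‖ := by gcongr; exact le_abs_self C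
      _ ≤ |C| * 1 := by gcongr; exact hZ1 n
      _ = |C| := mul_one _

/-! ### Invariance of the vacuum and the conclusion -/

section Main

variable {U T : OneParameterUnitaryGroup H}

/-- A vector fixed by `U` is fixed by `T`. -/
theorem OneParameterUnitaryGroup.apply_eq_self_of_commutation
    (hUT : ∀ a t : ℝ, U t * T a * U (-t) = T (Real.exp t * a)) {Ω : H}
    (hUΩ : ∀ t : ℝ, U t Ω = Ω) (a : ℝ) : T a Ω = Ω := by
  -- As `e^t a → 0` for `t → -∞`, a coefficient constant in `t` must equal `⟨Ω, Ω⟩`. Equality of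
  -- this inner product with `‖Ω‖²`, for vectors of equal norm, forces `T(a)Ω = Ω`.
  have h1 : ∀ t : ℝ, inner ℂ Ω (T (Real.exp t * a) Ω) = inner ℂ Ω (T a Ω) := by
    intro t
    have h2 := OneParameterUnitaryGroup.apply_comm hUT a t Ω
    rw [hUΩ] at h2
    have h3 := U.inner_apply_left (-t) Ω (T a Ω)
    rw [hUΩ, neg_neg, h2] at h3
    exact h3.symm
  have h2 : Tendsto (fun t : ℝ => inner ℂ Ω (T (Real.exp t * a) Ω)) atBot (𝓝 (inner ℂ Ω Ω)) := by
    have h3 := (T.continuous_apply Ω).tendsto (0 * a)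
    rw [zero_mul, T.map_zero_apply] at h3
    have h4 : Tendsto (fun t : ℝ => Real.exp t * a) atBot (𝓝 0) := by
      simpa using Real.tendsto_exp_atBot.mul_const a
    exact tendsto_const_nhds.inner (h3.comp h4)
  simp only [h1] at h2
  have h3 : inner ℂ Ω (T a Ω) = inner ℂ Ω Ω := tendsto_nhds_unique tendsto_const_nhds h2
  have h4 := norm_sub_sq (𝕜 := ℂ) Ω (T a Ω)
  rw [h3, T.norm_apply, inner_self_eq_norm_sq (𝕜 := ℂ)] at h4
  have h5 : ‖Ω - T a Ω‖ = 0 := by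
    have : ‖Ω - T a Ω‖ ^ 2 = 0 := by rw [h4]; ring
    exact pow_eq_zero_iff two_ne_zero |>.1 this
  exact (sub_eq_zero.1 (norm_eq_zero.1 h5)).symm

/-- Since `U` and `T` fix `Ω`, conjugating `X` moves `XΩ` by the group itself, so invariance of `S`
becomes invariance of the subspace `SΩ`. -/
theorem isPositiveOperator_of_invariant_submodule {Ω : H} (hUΩ : ∀ t : ℝ, U t Ω = Ω)
    (hUT : ∀ a t : ℝ, U t * T a * U (-t) = T (Real.exp t * a)) (S : Submodule ℂ (H →L[ℂ] H))
    (hd : Dense ((Submodule.span ℂ ((fun X : H →L[ℂ] H => X Ω) '' S) : Submodule ℂ H) : Set H))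
    (hUS : ∀ t : ℝ, ∀ X ∈ S, U t * X * U (-t) ∈ S)
    (hTS : ∀ a : ℝ, 0 ≤ a → ∀ X ∈ S, T a * X * T (-a) ∈ S)
    (hS : ∀ X ∈ S, X Ω ∈ (expNeg Real.pi U.generator).domain) :
    IsPositiveOperator T.generator := by
  let D : Submodule ℂ H := S.map (ContinuousLinearMap.apply ℂ H Ω).toLinearMap
  have hD : Submodule.span ℂ ((fun X : H →L[ℂ] H => X Ω) '' S) = D := by
    rw [← Submodule.span_eq D]
    rfl
  rw [hD] at hd
  have hTΩ := OneParameterUnitaryGroup.apply_eq_self_of_commutation hUT hUΩ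
  refine OneParameterUnitaryGroup.isPositiveOperator_generator_of_strip hUT hd ?_ ?_ ?_
  · rintro t _ ⟨X, hX, rfl⟩
    refine ⟨U t * X * U (-t), hUS t X hX, ?_⟩
    simp [hUΩ]
  · rintro a ha _ ⟨X, hX, rfl⟩
    refine ⟨T a * X * T (-a), hTS a ha X hX, ?_⟩
    simp [hTΩ]
  · rintro _ ⟨X, hX, rfl⟩
    exact exists_isStripExtension_of_mem_domain (hS X hX)

end Main

end

theorem mainTheorem10 {H : Type*} [NormedAddCommGroup H] [InnerProductSpace ℂ H] [CompleteSpace H]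
    (M : VonNeumannAlgebra H) (Ω : H) (hΩ : IsCyclicVector (M : Set (H →L[ℂ] H)) Ω)
    (U T : OneParameterUnitaryGroup H)
    (hUΩ : ∀ t : ℝ, U t Ω = Ω)
    (hUM : ∀ t : ℝ, (fun X : H →L[ℂ] H => U t * X * U (-t)) '' (M : Set (H →L[ℂ] H)) = M)
    (hTM : ∀ a : ℝ, 0 ≤ a →
      (fun X : H →L[ℂ] H => T a * X * T (-a)) '' (M : Set (H →L[ℂ] H)) ⊆ M)
    (hUT : ∀ a t : ℝ, U t * T a * U (-t) = T (Real.exp t * a))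
    (B : NonUnitalStarSubalgebra ℂ (H →L[ℂ] H))
    (hB : IsWeaklyDense (B : Set (H →L[ℂ] H)) (M : Set (H →L[ℂ] H)))
    (hBΩ : ∀ X ∈ B, X Ω ∈ (expNeg Real.pi U.generator).domain)
    (h : ((∀ t : ℝ, (fun X : H →L[ℂ] H => U t * X * U (-t)) '' (B : Set (H →L[ℂ] H)) = B) ∧
          (∀ a : ℝ, 0 ≤ a →
            (fun X : H →L[ℂ] H => T a * X * T (-a)) '' (B : Set (H →L[ℂ] H)) ⊆ B)) ∨
        IsBetaBounded Real.pi U.generator Ω B.toNonUnitalSubalgebra.toSubmodule) :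
    IsPositiveOperator T.generator := by
  rcases h with ⟨hUB, hTB⟩ | h
  · refine isPositiveOperator_of_invariant_submodule hUΩ hUT B.toNonUnitalSubalgebra.toSubmodule
      (hB.dense_orbit hΩ) (fun t X hX => ?_) (fun a ha X hX => ?_) hBΩ
    · exact (hUB t).subset ⟨X, hX, rfl⟩
    · exact hTB a ha ⟨X, hX, rfl⟩
  -- Here `B` need not be invariant; `M` is, and `π`-boundedness has placed all of `MΩ` in the
  -- domain.
  · refine isPositiveOperator_of_invariant_submodule hUΩ hUT
      M.toStarSubalgebra.toSubalgebra.toSubmodule hΩ (fun t X hX => ?_) (fun a ha X hX => ?_)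
      fun X hX => mem_domain_of_isBetaBounded M hB h hX
    · exact (hUM t).subset ⟨X, hX, rfl⟩
    · exact hTM a ha ⟨X, hX, rfl⟩
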